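/- Let $\Bbbk$ be a field and let $C$ be a coassociative counital coalgebra over $\Bbbk$ with comultiplication $\Delta(c)=c_{(1)}\otimes c_{(2)}$ and counit $\varepsilon$. The dual space $C^*$ is an algebra under $\langle fg,c\rangle=\langle f,c_{(1)}\rangle\langle g,c_{(2)}\rangle$, with unit $\varepsilon$. It acts on every right $C$-comodule $M$ from the left by $f\rightharpoonup m=m_{(0)}\langle f,m_{(1)}\rangle$ (in particular on $C$), and on $C$ from the right by $c\leftharpoonup f=\langle f,c_{(1)}\rangle c_{(2)}$. Let $\mathfrak{M}^C$ be the category of right $C$-comodules. For a left $C^*$-module $N$, let $N^{\mathrm{rat}}$ be its rational part, that is, the set of all $n\in N$ for which there is $\sum_i n_i\otimes c_i\in N\otimes_{\Bbbk} C$ with $fn=\sum_i\langle f,c_i\rangle n_i$ for all $f\in C^*$; it is a right $C$-comodule by $n\mapsto\sum_i n_i\otimes c_i$. The left exact and the right exact Nakayama functors $\mathbb{N}^{\mathrm L}_C,\mathbb{N}^{\mathrm R}_C:\mathfrak{M}^C\to\mathfrak{M}^C$ are defined by $$\mathbb{N}^{\mathrm L}_C(M)=\mathrm{Hom}^C(C,M)^{\mathrm{rat}},\qquad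 \mathbb{N}^{\mathrm R}_C(M)=C\otimes_{C^*}M,$$ where $C^*$ acts on $\mathrm{Hom}^C(C,M)$ by $(f\cdot\varphi)(c)=\varphi(c\leftharpoonup f)$, and $C\otimes_{C^*}M$ has the coaction $c\otimes_{C^*}m\mapsto(c_{(1)}\otimes_{C^*}m)\otimes c_{(2)}$. The coalgebra $C$ is called quasi-co-Frobenius (QcF) if, for some cardinal $\kappa$, there is an injective homomorphism $C\to(C^*)^{\oplus\kappa}$ of left $C^*$-modules and, for some cardinal $\kappa'$, there is an injective homomorphism $C\to(C^*)^{\oplus\kappa'}$ of right $C^*$-modules. Theorem. For a coalgebra $C$ over a field, the following are equivalent: (1) $C$ is QcF. (2) $\mathbb{N}^{\mathrm L}_C$ is an equivalence. (3) $\mathbb{N}^{\mathrm R}_C$ is an equivalence. (4) $\mathbb{N}^{\mathrm R}_C$ is exact and faithful. Suppose that these equivalent conditions hold, and let $S$ be a simple right $C$-comodule. Write $E(X)$ for an injective hull and $P(X)$ for a projective cover of a right $C$-comodule $X$ in $\mathfrak{M}^C$. Then $P(S)$, $E(\mathbb{N}^{\mathrm L}_C(S))$, $E(S)$ and $P(\mathbb{N}^{\mathrm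 R}_C(S))$ exist, and $$P(S)\cong E(\mathbb{N}^{\mathrm L}_C(S))\quad\text{and}\quad E(S)\cong P(\mathbb{N}^{\mathrm R}_C(S)).$$ -/

import Mathlib

open TensorProduct CategoryTheory

universe u v

noncomputable section

/-- The dual algebra `C^*` of a coalgebra `C`, with the convolution product
`(f * g)(c) = f(c₁) g(c₂)` and unit the counit. -/
abbrev DualAlg (k : Type u) (C : Type v) [Field k] [AddCommGroup C] [Module k C]
    [Coalgebra k C] : Type (max u v) :=
  WithConv (C →ₗ[k] k)

/-- A right `C`-comodule. -/
structure Comod (k : Type u) (C : Type v) [Field k] [AddCommGroup C] [Module k C]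
    [Coalgebra k C] where
  carrier : Type v
  [addCommGroup : AddCommGroup carrier]
  [module : Module k carrier]
  /-- the coaction `m ↦ m₀ ⊗ m₁` -/
  coact : carrier →ₗ[k] carrier ⊗[k] C
  coassoc : (TensorProduct.assoc k carrier C C).toLinearMap ∘ₗ coact.rTensor C ∘ₗ coact =
    (Coalgebra.comul (R := k) (A := C)).lTensor carrier ∘ₗ coact
  counit_coact : (TensorProduct.rid k carrier).toLinearMap ∘ₗ
    (Coalgebra.counit (R := k) (A := C)).lTensor carrier ∘ₗ coact = LinearMap.id

attribute [instance] Comod.addCommGroup Comod.module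

section

variable {k : Type u} {C : Type v} [Field k] [AddCommGroup C] [Module k C] [Coalgebra k C]

namespace Comod

/-- A homomorphism of right `C`-comodules. -/
@[ext]
structure Hom (M N : Comod k C) where
  toLin : M.carrier →ₗ[k] N.carrier
  comm : N.coact ∘ₗ toLin = toLin.rTensor C ∘ₗ M.coact

/-- The category of right `C`-comodules. -/
instance : Category (Comod k C) where
  Hom M N := Hom M N
  id M := ⟨LinearMap.id, by simp⟩
  comp f g := ⟨g.toLin ∘ₗ f.toLin, by
    rw [← LinearMap.comp_assoc, g.comm, LinearMap.comp_assoc, f.comm, LinearMap.rTensor_comp,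
      LinearMap.comp_assoc]⟩

variable {M N : Comod k C}

/-- The linear map underlying a morphism of comodules. -/
def lin (f : M ⟶ N) : M.carrier →ₗ[k] N.carrier := Hom.toLin f

theorem lin_comm (f : M ⟶ N) : N.coact ∘ₗ lin f = (lin f).rTensor C ∘ₗ M.coact := Hom.comm f

/-- A morphism of comodules from a colinear map. -/
def ofLin (f : M.carrier →ₗ[k] N.carrier) (h : N.coact ∘ₗ f = f.rTensor C ∘ₗ M.coact) : M ⟶ N :=
  Hom.mk f h

@[simp] theorem lin_ofLin (f : M.carrier →ₗ[k] N.carrier)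
    (h : N.coact ∘ₗ f = f.rTensor C ∘ₗ M.coact) : lin (ofLin f h) = f := rfl

@[simp] theorem lin_id : lin (𝟙 M) = LinearMap.id := rfl

@[simp] theorem lin_comp {P : Comod k C} (f : M ⟶ N) (g : N ⟶ P) :
    lin (f ≫ g) = lin g ∘ₗ lin f := rfl

theorem lin_injective : Function.Injective (lin : (M ⟶ N) → _) := fun _ _ h => Hom.ext h

@[ext] theorem hom_ext {f g : M ⟶ N} (h : lin f = lin g) : f = g := lin_injective h

instance : Zero (M ⟶ N) := ⟨ofLin 0 (by simp)⟩
instance : Add (M ⟶ N) := ⟨fun f g => ofLin (lin f + lin g) (by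
  rw [LinearMap.comp_add, LinearMap.rTensor_add, LinearMap.add_comp, lin_comm, lin_comm])⟩
instance : Neg (M ⟶ N) := ⟨fun f => ofLin (-lin f) (by
  rw [LinearMap.comp_neg, LinearMap.rTensor_neg, LinearMap.neg_comp, lin_comm])⟩
instance : Sub (M ⟶ N) := ⟨fun f g => ofLin (lin f - lin g) (by
  rw [LinearMap.comp_sub, LinearMap.rTensor_sub, LinearMap.sub_comp, lin_comm, lin_comm])⟩
instance : SMul ℕ (M ⟶ N) := ⟨fun n f => ofLin (n • lin f) (by
  rw [LinearMap.comp_smul, lin_comm, ← Nat.cast_smul_eq_nsmul k, ← Nat.cast_smul_eq_nsmul k,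
    LinearMap.rTensor_smul, LinearMap.smul_comp])⟩
instance : SMul ℤ (M ⟶ N) := ⟨fun n f => ofLin (n • lin f) (by
  rw [LinearMap.comp_smul, lin_comm, ← Int.cast_smul_eq_zsmul k, ← Int.cast_smul_eq_zsmul k,
    LinearMap.rTensor_smul, LinearMap.smul_comp])⟩

instance : AddCommGroup (M ⟶ N) :=
  lin_injective.addCommGroup lin rfl (fun _ _ => rfl) (fun _ => rfl) (fun _ _ => rfl)
    (fun _ _ => rfl) (fun _ _ => rfl)

@[simp] theorem lin_zero : lin (0 : M ⟶ N) = 0 := rfl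

@[simp] theorem lin_add (f g : M ⟶ N) : lin (f + g) = lin f + lin g := rfl

instance : Preadditive (Comod k C) where
  add_comp _ _ _ f f' g := by ext1; simp [LinearMap.comp_add]
  comp_add _ _ _ f g g' := by ext1; simp [LinearMap.add_comp]

/-- The left action `f ⇀ m = m₀ ⟨f, m₁⟩` of `C^*` on a right `C`-comodule. -/
def act (M : Comod k C) (f : DualAlg k C) : M.carrier →ₗ[k] M.carrier :=
  (TensorProduct.rid k M.carrier).toLinearMap ∘ₗ f.ofConv.lTensor M.carrier ∘ₗ M.coact

end Comod

/-! ### The two actions of `C^*` on `C` -/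

variable (k) in
/-- The left action `f ⇀ c = c₁ ⟨f, c₂⟩` of `C^*` on `C`. -/
def coalgActL (f : DualAlg k C) : C →ₗ[k] C :=
  (TensorProduct.rid k C).toLinearMap ∘ₗ f.ofConv.lTensor C ∘ₗ Coalgebra.comul

variable (k) in
/-- The right action `c ↼ f = ⟨f, c₁⟩ c₂` of `C^*` on `C`. -/
def coalgActR (f : DualAlg k C) : C →ₗ[k] C :=
  (TensorProduct.lid k C).toLinearMap ∘ₗ f.ofConv.rTensor C ∘ₗ Coalgebra.comul

theorem comul_coalgActR (f : DualAlg k C) :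
    Coalgebra.comul ∘ₗ coalgActR k f =
      (coalgActR k f).rTensor C ∘ₗ (Coalgebra.comul (R := k) (A := C)) := by
  have h1 : (Coalgebra.comul (R := k) (A := C)) ∘ₗ (TensorProduct.lid k C).toLinearMap ∘ₗ
      f.ofConv.rTensor C =
      ((TensorProduct.lid k C).toLinearMap ∘ₗ f.ofConv.rTensor C).rTensor C ∘ₗ
        (TensorProduct.assoc k C C C).symm.toLinearMap ∘ₗ
          (Coalgebra.comul (R := k) (A := C)).lTensor C := by
    ext a b
    simp only [TensorProduct.AlgebraTensorModule.curry_apply, LinearMap.restrictScalars_self,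
      TensorProduct.curry_apply, LinearMap.comp_apply, LinearMap.rTensor_tmul,
      LinearEquiv.coe_coe, TensorProduct.lid_tmul, map_smul, LinearMap.lTensor_tmul]
    generalize (Coalgebra.comul (R := k) b) = t
    induction t with
    | zero => simp
    | add x y hx hy => simp only [smul_add, hx, hy, TensorProduct.tmul_add, map_add]
    | tmul x y => simp [TensorProduct.smul_tmul']
  calc
    _ = ((Coalgebra.comul (R := k) (A := C)) ∘ₗ (TensorProduct.lid k C).toLinearMap ∘ₗ
          f.ofConv.rTensor C) ∘ₗ Coalgebra.comul := rfl
    _ = ((TensorProduct.lid k C).toLinearMap ∘ₗ f.ofConv.rTensor C).rTensor C ∘ₗ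
          Coalgebra.comul.rTensor C ∘ₗ Coalgebra.comul := by
      rw [h1, LinearMap.comp_assoc, LinearMap.comp_assoc, Coalgebra.coassoc_symm]
    _ = _ := by
      rw [← LinearMap.comp_assoc, ← LinearMap.rTensor_comp]; rfl

theorem convMul_eq_comp_coalgActR (f g : DualAlg k C) :
    (f * g).ofConv = g.ofConv ∘ₗ coalgActR k f := by
  ext c
  simp only [coalgActR, LinearMap.comp_apply, LinearEquiv.coe_coe]
  change LinearMap.mul' k k (TensorProduct.map f.ofConv g.ofConv (Coalgebra.comul c)) = _
  generalize (Coalgebra.comul (R := k) c) = t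
  induction t with
  | zero => simp
  | add x y hx hy => simp only [hx, hy, map_add]
  | tmul x y => simp

theorem coalgActR_mul (f g : DualAlg k C) :
    coalgActR k (f * g) = coalgActR k g ∘ₗ coalgActR k f := by
  conv_rhs => rw [coalgActR]
  rw [LinearMap.comp_assoc, LinearMap.comp_assoc, comul_coalgActR, coalgActR,
    convMul_eq_comp_coalgActR, LinearMap.rTensor_comp, LinearMap.comp_assoc]

theorem coalgActR_one : coalgActR k (1 : DualAlg k C) = LinearMap.id := by
  have h : (1 : DualAlg k C).ofConv = Coalgebra.counit := by ext; rfl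
  ext c
  simp [coalgActR, h]

theorem coalgActR_add (f g : DualAlg k C) :
    coalgActR k (f + g) = coalgActR k f + coalgActR k g := by
  simp [coalgActR, LinearMap.rTensor_add, LinearMap.add_comp, LinearMap.comp_add]

theorem coalgActR_zero : coalgActR k (0 : DualAlg k C) = 0 := by
  simp [coalgActR]

theorem coalgActR_smul (a : k) (f : DualAlg k C) :
    coalgActR k (a • f) = a • coalgActR k f := by
  simp [coalgActR, LinearMap.rTensor_smul, LinearMap.smul_comp, LinearMap.comp_smul]

/-! ### The right exact Nakayama functor `C ⊗_{C^*} M` -/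

/-- The relations `(c ↼ f) ⊗ m = c ⊗ (f ⇀ m)`. -/
def balancedRel (M : Comod k C) : Submodule k (C ⊗[k] M.carrier) :=
  Submodule.span k {t | ∃ (f : DualAlg k C) (c : C) (m : M.carrier),
    t = coalgActR k f c ⊗ₜ[k] m - c ⊗ₜ[k] M.act f m}

/-- The tensor product `C ⊗_{C^*} M` of the right `C^*`-module `C` and the left
`C^*`-module `M`. -/
abbrev BalancedTensor (M : Comod k C) : Type v := (C ⊗[k] M.carrier) ⧸ balancedRel M

/-- The linear map `c ↦ c ⊗_{C^*} m`. -/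
def balancedTmul (M : Comod k C) (m : M.carrier) : C →ₗ[k] BalancedTensor M :=
  (balancedRel M).mkQ ∘ₗ (TensorProduct.mk k C M.carrier).flip m

theorem balancedTmul_act (M : Comod k C) (f : DualAlg k C) (m : M.carrier) :
    balancedTmul M (M.act f m) = balancedTmul M m ∘ₗ coalgActR k f := by
  ext c
  symm
  refine (Submodule.Quotient.eq _).2 (Submodule.subset_span ⟨f, c, m, rfl⟩)

theorem balancedTensor_hom_ext {M : Comod k C} {V : Type*} [AddCommGroup V] [Module k V]
    {f g : BalancedTensor M →ₗ[k] V}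
    (h : ∀ m, f ∘ₗ balancedTmul M m = g ∘ₗ balancedTmul M m) : f = g := by
  refine Submodule.linearMap_qext _ (TensorProduct.ext' fun c m => ?_)
  exact LinearMap.congr_fun (h m) c

/-- The map `c ⊗ m ↦ (c₁ ⊗_{C^*} m) ⊗ c₂`. -/
def balancedPreCoact (M : Comod k C) : C ⊗[k] M.carrier →ₗ[k] BalancedTensor M ⊗[k] C :=
  (balancedRel M).mkQ.rTensor C ∘ₗ (TensorProduct.rightComm k C C M.carrier).toLinearMap ∘ₗ
    Coalgebra.comul.rTensor M.carrier

theorem balancedPreCoact_tmul (M : Comod k C) (c : C) (m : M.carrier) :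
    balancedPreCoact M (c ⊗ₜ m) = (balancedTmul M m).rTensor C (Coalgebra.comul c) := by
  simp only [balancedPreCoact, LinearMap.comp_apply, LinearMap.rTensor_tmul, LinearEquiv.coe_coe]
  generalize (Coalgebra.comul (R := k) c) = t
  induction t with
  | zero => simp
  | add x y hx hy => simp only [hx, hy, map_add, TensorProduct.add_tmul]
  | tmul x y => simp [balancedTmul]

/-- The coaction `c ⊗_{C^*} m ↦ (c₁ ⊗_{C^*} m) ⊗ c₂`. -/
def balancedCoact (M : Comod k C) : BalancedTensor M →ₗ[k] BalancedTensor M ⊗[k] C :=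
  (balancedRel M).liftQ (balancedPreCoact M) (by
    refine Submodule.span_le.2 ?_
    rintro _ ⟨f, c, m, rfl⟩
    have h := LinearMap.congr_fun (comul_coalgActR (k := k) (C := C) f) c
    simp only [LinearMap.comp_apply] at h
    rw [SetLike.mem_coe, LinearMap.mem_ker, map_sub, balancedPreCoact_tmul, balancedPreCoact_tmul,
      balancedTmul_act, LinearMap.rTensor_comp, h, LinearMap.comp_apply, sub_self])

theorem balancedCoact_comp (M : Comod k C) (m : M.carrier) :
    balancedCoact M ∘ₗ balancedTmul M m = (balancedTmul M m).rTensor C ∘ₗ Coalgebra.comul :=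
  LinearMap.ext fun c => balancedPreCoact_tmul M c m

variable (k C) in
/-- The right exact Nakayama functor on objects: `C ⊗_{C^*} M`. -/
def nakRObj (M : Comod k C) : Comod k C where
  carrier := BalancedTensor M
  coact := balancedCoact M
  coassoc := by
    refine balancedTensor_hom_ext fun m => ?_
    set θ := balancedTmul M m
    have hθ : balancedCoact M ∘ₗ θ = θ.rTensor C ∘ₗ Coalgebra.comul := balancedCoact_comp M m
    calc
      _ = (TensorProduct.assoc k _ C C).toLinearMap ∘ₗ
            (balancedCoact M ∘ₗ θ).rTensor C ∘ₗ Coalgebra.comul := by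
        rw [LinearMap.rTensor_comp, LinearMap.comp_assoc, LinearMap.comp_assoc, hθ,
          LinearMap.comp_assoc]
      _ = ((TensorProduct.assoc k _ C C).toLinearMap ∘ₗ (θ.rTensor C).rTensor C) ∘ₗ
            Coalgebra.comul.rTensor C ∘ₗ Coalgebra.comul := by
        rw [hθ, LinearMap.rTensor_comp]; rfl
      _ = (θ.rTensor (C ⊗[k] C) ∘ₗ (TensorProduct.assoc k C C C).toLinearMap) ∘ₗ
            Coalgebra.comul.rTensor C ∘ₗ Coalgebra.comul := by
        congr 1
        ext
        simp
      _ = θ.rTensor (C ⊗[k] C) ∘ₗ Coalgebra.comul.lTensor C ∘ₗ Coalgebra.comul := by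
        rw [LinearMap.comp_assoc, Coalgebra.coassoc]
      _ = _ := by
        rw [LinearMap.comp_assoc, hθ, ← LinearMap.comp_assoc, ← LinearMap.comp_assoc,
          LinearMap.lTensor_comp_rTensor, LinearMap.rTensor_comp_lTensor]
  counit_coact := by
    refine balancedTensor_hom_ext fun m => ?_
    set θ := balancedTmul M m
    have hθ : balancedCoact M ∘ₗ θ = θ.rTensor C ∘ₗ Coalgebra.comul := balancedCoact_comp M m
    calc
      _ = (TensorProduct.rid k _).toLinearMap ∘ₗ (Coalgebra.counit.lTensor _ ∘ₗ θ.rTensor C) ∘ₗ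
            Coalgebra.comul := by
        rw [LinearMap.comp_assoc, LinearMap.comp_assoc, hθ]; rfl
      _ = ((TensorProduct.rid k _).toLinearMap ∘ₗ θ.rTensor k) ∘ₗ Coalgebra.counit.lTensor C ∘ₗ
            Coalgebra.comul := by
        rw [LinearMap.lTensor_comp_rTensor, ← LinearMap.rTensor_comp_lTensor]; rfl
      _ = _ := by
        ext c
        simp

theorem act_comp_lin {M N : Comod k C} (g : M ⟶ N) (f : DualAlg k C) :
    N.act f ∘ₗ Comod.lin g = Comod.lin g ∘ₗ M.act f := by
  unfold Comod.act
  rw [LinearMap.comp_assoc, LinearMap.comp_assoc, Comod.lin_comm,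
    ← LinearMap.comp_assoc _ _ (f.ofConv.lTensor _), LinearMap.lTensor_comp_rTensor,
    ← LinearMap.rTensor_comp_lTensor]
  ext m
  simp only [LinearMap.comp_apply]
  generalize M.coact m = t
  induction t with
  | zero => simp
  | add x y hx hy => simp only [hx, hy, map_add]
  | tmul x y => simp

/-- The map `C ⊗_{C^*} g`. -/
def balancedMap {M N : Comod k C} (g : M ⟶ N) : BalancedTensor M →ₗ[k] BalancedTensor N :=
  (balancedRel M).mapQ (balancedRel N) ((Comod.lin g).lTensor C) (by
    refine Submodule.span_le.2 ?_
    rintro _ ⟨f, c, m, rfl⟩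
    have h : Comod.lin g (M.act f m) = N.act f (Comod.lin g m) :=
      (LinearMap.congr_fun (act_comp_lin g f) m).symm
    refine Submodule.subset_span ⟨f, c, Comod.lin g m, ?_⟩
    rw [map_sub, LinearMap.lTensor_tmul, LinearMap.lTensor_tmul, h])

theorem balancedMap_comp {M N : Comod k C} (g : M ⟶ N) (m : M.carrier) :
    balancedMap g ∘ₗ balancedTmul M m = balancedTmul N (Comod.lin g m) := rfl

variable (k C) in
/-- The right exact Nakayama functor `C ⊗_{C^*} (-)`. -/
def nakR : Comod k C ⥤ Comod k C where
  obj := nakRObj k C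
  map {M N} g := Comod.ofLin (M := nakRObj k C M) (N := nakRObj k C N) (balancedMap g) (by
    refine balancedTensor_hom_ext fun m => ?_
    change balancedCoact N ∘ₗ (balancedMap g ∘ₗ balancedTmul M m) =
      (balancedMap g).rTensor C ∘ₗ (balancedCoact M ∘ₗ balancedTmul M m)
    rw [balancedMap_comp, balancedCoact_comp, balancedCoact_comp, ← LinearMap.comp_assoc,
      ← LinearMap.rTensor_comp, balancedMap_comp])
  map_id M := by
    ext1
    exact balancedTensor_hom_ext (M := M) fun m => rfl
  map_comp f g := by
    ext1
    exact balancedTensor_hom_ext fun m => rfl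

/-! ### Rational parts -/

section Rational

variable (N : Type*) [AddCommGroup N] [Module k N]

variable {N} in
/-- Evaluation `n ⊗ c ↦ ⟨f, c⟩ n`. -/
def tensorEval (f : DualAlg k C) : N ⊗[k] C →ₗ[k] N :=
  (TensorProduct.rid k N).toLinearMap ∘ₗ f.ofConv.lTensor N

variable {N} in
@[simp] theorem tensorEval_tmul (f : DualAlg k C) (n : N) (c : C) :
    tensorEval f (n ⊗ₜ[k] c) = f.ofConv c • n := by simp [tensorEval]

variable {N} in
theorem tensorEval_rTensor {N' : Type*} [AddCommGroup N'] [Module k N'] (g : N →ₗ[k] N')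
    (f : DualAlg k C) (t : N ⊗[k] C) : tensorEval f (g.rTensor C t) = g (tensorEval f t) := by
  induction t with
  | zero => simp
  | add x y hx hy => simp only [hx, hy, map_add]
  | tmul x y => simp

variable {N} in
theorem tensor_eq_sum_eval (t : N ⊗[k] C) :
    ∃ (ι : Type v) (s : Finset ι) (f : ι → DualAlg k C) (c : ι → C),
      t = ∑ i ∈ s, tensorEval (f i) t ⊗ₜ[k] c i := by
  classical
  let b := Module.Basis.ofVectorSpace k C
  obtain ⟨x, hx⟩ := TensorProduct.eq_repr_basis_right b t
  refine ⟨_, x.support, fun i => WithConv.toConv (b.coord i), fun i => b i, ?_⟩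
  have h : ∀ i, tensorEval (WithConv.toConv (b.coord i)) t = x i := by
    intro i
    rw [← hx, Finsupp.sum, map_sum]
    simp [Finsupp.single_apply, eq_comm]
  simp only [h]
  exact hx.symm

variable {N} in
theorem tensorEval_ext {t t' : N ⊗[k] C} (h : ∀ f : DualAlg k C, tensorEval f t = tensorEval f t') :
    t = t' := by
  rw [← sub_eq_zero]
  obtain ⟨_, s, f, c, hs⟩ := tensor_eq_sum_eval (t - t')
  rw [hs]
  exact Finset.sum_eq_zero fun i _ => by
    rw [map_sub, h (f i), sub_self, TensorProduct.zero_tmul]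

variable {N} in
theorem tensorEval_mul (f g : DualAlg k C) (t : N ⊗[k] C) :
    tensorEval (f * g) t =
      tensorEval f (tensorEval g ((TensorProduct.assoc k N C C).symm
        ((Coalgebra.comul (R := k) (A := C)).lTensor N t))) := by
  induction t with
  | zero => simp
  | add x y hx hy => simp only [hx, hy, map_add]
  | tmul n c =>
    rw [tensorEval_tmul, LinearMap.lTensor_tmul]
    change LinearMap.mul' k k (TensorProduct.map f.ofConv g.ofConv (Coalgebra.comul c)) • n = _
    generalize (Coalgebra.comul (R := k) c) = t
    induction t with
    | zero => simp
    | add x y hx hy => simp only [map_add, add_smul, hx, hy, TensorProduct.tmul_add]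
    | tmul x y => simp [smul_smul, mul_comm]

variable [Module (DualAlg k C) N] [IsScalarTower k (DualAlg k C) N]

variable (k C) in
/-- The rational part of a left `C^*`-module `N`: the elements `n` for which there is
`∑ nᵢ ⊗ cᵢ ∈ N ⊗ C` with `f n = ∑ ⟨f, cᵢ⟩ nᵢ` for all `f ∈ C^*`. -/
def ratPart : Submodule k N where
  carrier := {n | ∃ t : N ⊗[k] C, ∀ f : DualAlg k C, f • n = tensorEval f t}
  zero_mem' := ⟨0, by simp⟩
  add_mem' := by
    rintro m n ⟨t, ht⟩ ⟨t', ht'⟩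
    exact ⟨t + t', fun f => by rw [smul_add, ht, ht', map_add]⟩
  smul_mem' := by
    rintro a n ⟨t, ht⟩
    exact ⟨a • t, fun f => by
      rw [map_smul, ← ht, smul_comm]⟩

variable {N} in
theorem smul_mem_ratPart (f : DualAlg k C) {n : N} (hn : n ∈ ratPart k C N) :
    f • n ∈ ratPart k C N := by
  obtain ⟨t, ht⟩ := hn
  refine ⟨tensorEval f ((TensorProduct.assoc k N C C).symm
    ((Coalgebra.comul (R := k) (A := C)).lTensor N t)), fun g => ?_⟩
  rw [smul_smul, ht, tensorEval_mul]

theorem exists_ratCoact (n : ratPart k C N) :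
    ∃ t : ratPart k C N ⊗[k] C, ∀ f : DualAlg k C, f • (n : N) = (tensorEval f t : ratPart k C N) := by
  obtain ⟨n, hn⟩ := n
  obtain ⟨t, ht⟩ := id hn
  obtain ⟨_, s, f, c, hs⟩ := tensor_eq_sum_eval t
  refine ⟨∑ i ∈ s, (⟨f i • n, smul_mem_ratPart (f i) hn⟩ : ratPart k C N) ⊗ₜ[k] c i, fun g => ?_⟩
  have h : (ratPart k C N).subtype.rTensor C
      (∑ i ∈ s, (⟨f i • n, smul_mem_ratPart (f i) hn⟩ : ratPart k C N) ⊗ₜ[k] c i) = t := by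
    rw [map_sum]
    conv_rhs => rw [hs]
    exact Finset.sum_congr rfl fun i _ => by rw [← ht]; rfl
  change g • n = (ratPart k C N).subtype _
  rw [← tensorEval_rTensor, h, ht]

/-- The coaction on the rational part: `n ↦ ∑ nᵢ ⊗ cᵢ`, the unique tensor with
`f n = ∑ ⟨f, cᵢ⟩ nᵢ` for all `f ∈ C^*`. -/
def ratCoact : ratPart k C N →ₗ[k] ratPart k C N ⊗[k] C where
  toFun n := (exists_ratCoact N n).choose
  map_add' m n := tensorEval_ext fun f => Subtype.ext <| by
    rw [← (exists_ratCoact N (m + n)).choose_spec, map_add, Submodule.coe_add, Submodule.coe_add,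
      ← (exists_ratCoact N m).choose_spec, ← (exists_ratCoact N n).choose_spec, smul_add]
  map_smul' a n := tensorEval_ext fun f => Subtype.ext <| by
    rw [← (exists_ratCoact N (a • n)).choose_spec, map_smul, RingHom.id_apply, Submodule.coe_smul,
      Submodule.coe_smul, ← (exists_ratCoact N n).choose_spec, smul_comm]

theorem tensorEval_ratCoact (f : DualAlg k C) (n : ratPart k C N) :
    (tensorEval f (ratCoact (k := k) (C := C) N n) : ratPart k C N) = f • (n : N) :=
  ((exists_ratCoact N n).choose_spec f).symm

end Rational

section RationalComod

variable (N : Type v) [AddCommGroup N] [Module k N]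
  [Module (DualAlg k C) N] [IsScalarTower k (DualAlg k C) N]

variable (k C) in
/-- The rational part of a left `C^*`-module, as a right `C`-comodule. -/
def ratComod : Comod k C where
  carrier := ratPart k C N
  coact := ratCoact N
  coassoc := by
    ext n
    apply (TensorProduct.assoc k _ C C).symm.injective
    refine tensorEval_ext fun g => tensorEval_ext fun f => Subtype.ext ?_
    simp only [LinearMap.comp_apply, LinearEquiv.coe_coe, LinearEquiv.symm_apply_apply]
    rw [tensorEval_rTensor, tensorEval_ratCoact, tensorEval_ratCoact, ← tensorEval_mul,
      tensorEval_ratCoact, mul_smul]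
  counit_coact := by
    ext n
    have h : (1 : DualAlg k C).ofConv = Coalgebra.counit := by ext; rfl
    have h1 := tensorEval_ratCoact N (1 : DualAlg k C) n
    rw [one_smul, tensorEval, h] at h1
    exact h1

variable {N} {N' : Type v} [AddCommGroup N'] [Module k N']
  [Module (DualAlg k C) N'] [IsScalarTower k (DualAlg k C) N']

theorem map_mem_ratPart (g : N →ₗ[k] N') (hg : ∀ (f : DualAlg k C) (n : N), g (f • n) = f • g n)
    (n : N) (hn : n ∈ ratPart k C N) : g n ∈ ratPart k C N' := by
  obtain ⟨t, ht⟩ := hn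
  exact ⟨g.rTensor C t, fun f => by rw [← hg, ht, tensorEval_rTensor]⟩

theorem ratCoact_map (g : N →ₗ[k] N') (hg : ∀ (f : DualAlg k C) (n : N), g (f • n) = f • g n)
    (n : ratPart k C N) : ratCoact N' (g.restrict (map_mem_ratPart g hg) n) =
      (g.restrict (map_mem_ratPart g hg)).rTensor C (ratCoact N n) := by
  refine tensorEval_ext fun f => Subtype.ext ?_
  rw [tensorEval_rTensor, tensorEval_ratCoact]
  exact (hg f n).symm.trans (congrArg g (tensorEval_ratCoact N f n)).symm

/-- The morphism of comodules induced on rational parts by a `C^*`-linear map. -/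
def ratMap (g : N →ₗ[k] N') (hg : ∀ (f : DualAlg k C) (n : N), g (f • n) = f • g n) :
    ratComod k C N ⟶ ratComod k C N' :=
  Comod.ofLin (M := ratComod k C N) (N := ratComod k C N') (g.restrict (map_mem_ratPart g hg)) (by
    ext n
    exact ratCoact_map g hg n)

end RationalComod

/-! ### The left exact Nakayama functor `Hom^C(C, M)^rat` -/

variable (k C) in
/-- `C` as a right `C`-comodule. -/
def regularComod : Comod k C where
  carrier := C
  coact := Coalgebra.comul
  coassoc := Coalgebra.coassoc
  counit_coact := by ext c; simp

/-- The space `Hom^C(C, M)` of morphisms of right `C`-comodules `C → M`. -/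
def HomReg (M : Comod k C) : Type v := regularComod k C ⟶ M

namespace HomReg

variable (M : Comod k C)

instance : AddCommGroup (HomReg M) := inferInstanceAs (AddCommGroup (regularComod k C ⟶ M))

/-- The linear map `C → M` underlying an element of `Hom^C(C, M)`. -/
def lin {M : Comod k C} (φ : HomReg M) : C →ₗ[k] M.carrier := Comod.lin φ

theorem lin_injective : Function.Injective (lin (M := M)) := fun _ _ h => Comod.Hom.ext h

theorem lin_add (φ ψ : HomReg M) : lin (φ + ψ) = lin φ + lin ψ := rfl

theorem lin_zero : lin (0 : HomReg M) = 0 := rfl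

variable {M} in
theorem comm (φ : HomReg M) : M.coact ∘ₗ lin φ = (lin φ).rTensor C ∘ₗ Coalgebra.comul :=
  Comod.lin_comm φ

variable {M} in
/-- An element of `Hom^C(C, M)` from a colinear map. -/
def ofLin (φ : C →ₗ[k] M.carrier) (h : M.coact ∘ₗ φ = φ.rTensor C ∘ₗ Coalgebra.comul) :
    HomReg M :=
  Comod.ofLin (M := regularComod k C) φ h

instance : SMul k (HomReg M) := ⟨fun a φ => ofLin (a • lin φ) (by
  rw [LinearMap.comp_smul, comm, LinearMap.rTensor_smul, LinearMap.smul_comp])⟩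

theorem lin_smul (a : k) (φ : HomReg M) : lin (a • φ) = a • lin φ := rfl

instance : Module k (HomReg M) :=
  (lin_injective M).module k ⟨⟨lin, lin_zero M⟩, lin_add M⟩ (lin_smul M)

/-- The action `(f φ)(c) = φ(c ↼ f)` of `C^*` on `Hom^C(C, M)`. -/
instance : SMul (DualAlg k C) (HomReg M) :=
  ⟨fun f φ => ofLin (lin φ ∘ₗ coalgActR k f) (by
    rw [← LinearMap.comp_assoc, comm, LinearMap.comp_assoc, comul_coalgActR,
      LinearMap.rTensor_comp, LinearMap.comp_assoc])⟩

theorem lin_dual_smul (f : DualAlg k C) (φ : HomReg M) :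
    lin (f • φ) = lin φ ∘ₗ coalgActR k f := rfl

instance : Module (DualAlg k C) (HomReg M) where
  one_smul φ := lin_injective M (by rw [lin_dual_smul, coalgActR_one, LinearMap.comp_id])
  mul_smul f g φ := lin_injective M (by
    rw [lin_dual_smul, lin_dual_smul, lin_dual_smul, coalgActR_mul, LinearMap.comp_assoc])
  smul_zero f := lin_injective M (by rw [lin_dual_smul, lin_zero, LinearMap.zero_comp])
  smul_add f φ ψ := lin_injective M (by
    rw [lin_add, lin_dual_smul, lin_dual_smul, lin_dual_smul, lin_add, LinearMap.add_comp])
  add_smul f g φ := lin_injective M (by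
    rw [lin_add, lin_dual_smul, lin_dual_smul, lin_dual_smul, coalgActR_add, LinearMap.comp_add])
  zero_smul φ := lin_injective M (by
    rw [lin_dual_smul, coalgActR_zero, LinearMap.comp_zero, lin_zero])

instance : IsScalarTower k (DualAlg k C) (HomReg M) :=
  ⟨fun a f φ => lin_injective M (by
    rw [lin_smul, lin_dual_smul, lin_dual_smul, coalgActR_smul, LinearMap.comp_smul])⟩

/-- Composition with a morphism `M ⟶ M'`, as a linear map `Hom^C(C, M) → Hom^C(C, M')`. -/
def postcomp {M M' : Comod k C} (g : M ⟶ M') : HomReg M →ₗ[k] HomReg M' where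
  toFun φ := (show regularComod k C ⟶ M from φ) ≫ g
  map_add' _ _ := Preadditive.add_comp _ _ _ _ _ _
  map_smul' _ _ := lin_injective M' (LinearMap.comp_smul _ _ _)

theorem postcomp_dual_smul {M M' : Comod k C} (g : M ⟶ M') (f : DualAlg k C) (φ : HomReg M) :
    postcomp g (f • φ) = f • postcomp g φ := rfl

end HomReg

variable (k C) in
/-- The left exact Nakayama functor `Hom^C(C, -)^rat`. -/
def nakL : Comod k C ⥤ Comod k C where
  obj M := ratComod k C (HomReg M)
  map g := ratMap (HomReg.postcomp g) (HomReg.postcomp_dual_smul g)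
  map_id M := by ext n : 2; exact Subtype.ext (HomReg.lin_injective _ rfl)
  map_comp f g := by ext n : 2; exact Subtype.ext (HomReg.lin_injective _ rfl)

/-! ### Quasi-co-Frobenius coalgebras, injective hulls, projective covers -/

variable (k C) in
/-- `C` is left quasi-co-Frobenius: there is an injective homomorphism of left `C^*`-modules
from `C` to a direct sum of copies of `C^*`. -/
def IsLeftQcF : Prop :=
  ∃ (κ : Type v) (φ : C →ₗ[k] (κ →₀ DualAlg k C)), Function.Injective φ ∧
    ∀ (f : DualAlg k C) (c : C), φ (coalgActL k f c) = f • φ c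

variable (k C) in
/-- `C` is right quasi-co-Frobenius: there is an injective homomorphism of right `C^*`-modules
from `C` to a direct sum of copies of `C^*`. -/
def IsRightQcF : Prop :=
  ∃ (κ : Type v) (φ : C →ₗ[k] (κ →₀ DualAlg k C)), Function.Injective φ ∧
    ∀ (f : DualAlg k C) (c : C), φ (coalgActR k f c) = MulOpposite.op f • φ c

variable (k C) in
/-- `C` is quasi-co-Frobenius. -/
def IsQcF : Prop := IsLeftQcF k C ∧ IsRightQcF k C

/-- `i : S ⟶ E` is an injective hull of `S`: an essential monomorphism into an injective
object. -/
structure IsInjectiveHull {S E : Comod k C} (i : S ⟶ E) : Prop where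
  injective : Injective E
  mono : Mono i
  essential : ∀ ⦃X : Comod k C⦄ (g : E ⟶ X), Mono (i ≫ g) → Mono g

/-- `p : P ⟶ S` is a projective cover of `S`: a superfluous epimorphism from a projective
object. -/
structure IsProjectiveCover {P S : Comod k C} (p : P ⟶ S) : Prop where
  projective : Projective P
  epi : Epi p
  superfluous : ∀ ⦃X : Comod k C⦄ (g : X ⟶ P), Epi (g ≫ p) → Epi g

end

end

/-!
Right `C`-comodules are the rational left `C^*`-modules, and the theorem is about homomorphisms
between `C` and `C^*`. Homomorphisms of left `C^*`-modules `C → C^*`, homomorphisms of right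
`C^*`-modules `C → C^*` and linear forms on `C ⊗_{C^*} C` are all the same thing, namely bilinear
forms `B` on `C` with `B (c ↼ f) d = B c (f ⇀ d)` (`balancedForms`). The coalgebra is called left
or right torsionless when these forms separate its elements in the second or the first variable
(`LeftTorsionless`, `RightTorsionless`). Everything is deduced from the fact that `C` is
quasi-co-Frobenius if and only if it is torsionless on both sides (`isQcF_iff_torsionless`).

If `C` is left torsionless, then on every finite-dimensional subspace the counit is a sum of
functionals `B c`. This gives local units of finite rank in `C^*`, and a dual basis for every
finite-dimensional left submodule of `C`, with coordinates in `C^*`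
(`LeftTorsionless.exists_dual_basis`). The functor `C ⊗_{C^*} -` is left adjoint to
`Hom^C(C, -)^rat`. By the dual basis property the unit of the adjunction is an isomorphism
(`LeftTorsionless.isIso_unit`); if `C` is also right torsionless, then so is the counit
(`isIso_counit`), and both functors are equivalences.

Conversely, if `C ⊗_{C^*} -` is faithful, then no nonzero `d` is killed by all balanced forms, since
`C ⊗_{C^*} -` would send the inclusion of `C^* ⇀ d` in `C` to zero. Then `Hom(C, Y)` is
finite-dimensional for all finite-dimensional `Y` (`LeftTorsionless.finite_hom`), so functionals `f`
of finite rank on one side have finite rank on the other side. For such `f` the module `C^* f` is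
finitely generated inside a power of `C`, and preservation of monomorphisms shows that `f c = 0`
whenever `c ⊗ d = 0` for all `d` (`apply_eq_zero_of_balancedTmul_eq_zero`). Hence `C` is right
torsionless.

Torsionless only says that `C` embeds into a product of copies of `C^*`. To embed it into a direct
sum, `C` is decomposed into finite-dimensional direct summands with essential simple submodules, the
ranges of idempotents obtained from endomorphisms of minimal rank
(`SeparatesDisjoint.exists_decomposition`). A homomorphism to `C^*` that does not kill the simple
submodule of a summand is injective on this summand.

For a simple comodule `S`, embedded in `C`, the same construction gives a finite-dimensional direct
summand `E` of `C` that is an injective hull of `S`. It is projective by the dual basis property,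
and it covers `C ⊗_{C^*} S` by `x ↦ x ⊗ s`. This is a projective cover because one of the
endomorphisms `h` and `1 - h` of `E` is always injective
(`exists_isInjectiveHull_isProjectiveCover`). The equivalence `Hom^C(C, -)^rat` carries this hull
and this cover to those in the other isomorphism.
-/

noncomputable section

/-! ### Comodules as rational modules over the dual algebra -/

section Basics

variable {k : Type u} {C : Type v} [Field k] [AddCommGroup C] [Module k C] [Coalgebra k C]

namespace Comod

theorem act_eq_tensorEval (M : Comod k C) (f : DualAlg k C) (m : M.carrier) :
    M.act f m = tensorEval f (M.coact m) := rfl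

theorem act_mul (M : Comod k C) (f g : DualAlg k C) (m : M.carrier) :
    M.act (f * g) m = M.act f (M.act g m) := by
  have h := LinearMap.congr_fun M.coassoc m
  simp only [LinearMap.comp_apply, LinearEquiv.coe_coe] at h
  rw [act_eq_tensorEval, tensorEval_mul, ← h, LinearEquiv.symm_apply_apply, tensorEval_rTensor]
  rfl

theorem act_one (M : Comod k C) (m : M.carrier) : M.act (1 : DualAlg k C) m = m := by
  have h : (1 : DualAlg k C).ofConv = Coalgebra.counit := by ext; rfl
  rw [act, h]
  exact LinearMap.congr_fun M.counit_coact m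

/-- A right comodule is a left module over the dual algebra, by `f • m = f ⇀ m`. -/
instance (M : Comod k C) : Module (DualAlg k C) M.carrier where
  smul f m := M.act f m
  one_smul := M.act_one
  mul_smul := M.act_mul
  smul_zero f := (M.act f).map_zero
  smul_add f := (M.act f).map_add
  add_smul f g m := by
    change M.act (f + g) m = M.act f m + M.act g m
    simp [act, LinearMap.lTensor_add, map_add]
  zero_smul m := by
    change M.act 0 m = 0
    simp [act]

theorem smul_def (M : Comod k C) (f : DualAlg k C) (m : M.carrier) : f • m = M.act f m := rfl

instance (M : Comod k C) : IsScalarTower k (DualAlg k C) M.carrier where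
  smul_assoc a f m := by
    change M.act (a • f) m = a • M.act f m
    simp [act, LinearMap.lTensor_smul]

variable {M N : Comod k C}

/-- The `C^*`-linear map underlying a morphism of comodules. -/
def dualLin (g : M ⟶ N) : M.carrier →ₗ[DualAlg k C] N.carrier where
  toFun := lin g
  map_add' := (lin g).map_add
  map_smul' f m := (LinearMap.congr_fun (act_comp_lin g f) m).symm

theorem lin_smul (g : M ⟶ N) (f : DualAlg k C) (m : M.carrier) : lin g (f • m) = f • lin g m :=
  (dualLin g).map_smul f m

/-- A `C^*`-linear map between comodules is colinear. -/
def ofDualLin (g : M.carrier →ₗ[DualAlg k C] N.carrier) : M ⟶ N :=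
  ofLin (g.restrictScalars k) (LinearMap.ext fun m => tensorEval_ext fun f => by
    rw [LinearMap.comp_apply, LinearMap.comp_apply, tensorEval_rTensor]
    exact (g.map_smul f m).symm)

@[simp] theorem lin_ofDualLin (g : M.carrier →ₗ[DualAlg k C] N.carrier) (m : M.carrier) :
    lin (ofDualLin g) m = g m := rfl

theorem mem_ratPart (m : M.carrier) : m ∈ ratPart k C M.carrier := ⟨M.coact m, fun _ => rfl⟩

end Comod

section RatComod

variable {N : Type v} [AddCommGroup N] [Module k N]
  [Module (DualAlg k C) N] [IsScalarTower k (DualAlg k C) N]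

variable (k C) in
/-- The inclusion of the rational part, as a `C^*`-linear map. -/
def ratInclusion (N : Type v) [AddCommGroup N] [Module k N]
    [Module (DualAlg k C) N] [IsScalarTower k (DualAlg k C) N] :
    (ratComod k C N).carrier →ₗ[DualAlg k C] N where
  toFun := (ratPart k C N).subtype
  map_add' := (ratPart k C N).subtype.map_add
  map_smul' f n := tensorEval_ratCoact N f n

theorem ratInclusion_injective : Function.Injective (ratInclusion k C N) :=
  Subtype.val_injective

/-- A `C^*`-linear map from a comodule takes values in the rational part. -/
def toRatComod {M : Comod k C} (g : M.carrier →ₗ[DualAlg k C] N) : M ⟶ ratComod k C N :=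
  Comod.ofDualLin (N := ratComod k C N)
    { toFun := fun m => ⟨g m, map_mem_ratPart (g.restrictScalars k) g.map_smul m
        (Comod.mem_ratPart m)⟩
      map_add' := fun m n => Subtype.ext (g.map_add m n)
      map_smul' := fun f m => ratInclusion_injective (by
        refine Eq.trans ?_ ((ratInclusion k C N).map_smul f _).symm
        exact g.map_smul f m) }

end RatComod

namespace Comod

variable {M N : Comod k C}

/-- Submodules of comodules are rational. -/
theorem mem_ratPart_submodule (K : Submodule (DualAlg k C) M.carrier) (m : K) :
    m ∈ ratPart k C K := by
  obtain ⟨ι, s, f, c, h⟩ := tensor_eq_sum_eval (M.coact m)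
  refine ⟨∑ i ∈ s, (f i • m) ⊗ₜ[k] c i, fun g => Subtype.ext ?_⟩
  have h' : ((g • m : K) : M.carrier) = tensorEval g (M.coact m) := rfl
  rw [h', h, map_sum, map_sum, Submodule.coe_sum]
  refine Finset.sum_congr rfl fun i _ => ?_
  rw [tensorEval_tmul, tensorEval_tmul]
  rfl

/-- The subcomodule given by a `C^*`-submodule. -/
abbrev sub (K : Submodule (DualAlg k C) M.carrier) : Comod k C := ratComod k C K

/-- The inclusion of a subcomodule. -/
def subι (K : Submodule (DualAlg k C) M.carrier) : sub K ⟶ M :=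
  ofDualLin (K.subtype ∘ₗ ratInclusion k C K)

/-- An element of a submodule as an element of the subcomodule. -/
def subMk (K : Submodule (DualAlg k C) M.carrier) (m : K) : (sub K).carrier :=
  (⟨m, mem_ratPart_submodule K m⟩ : ratPart k C K)

theorem subι_mem (K : Submodule (DualAlg k C) M.carrier) (m : (sub K).carrier) :
    lin (subι K) m ∈ K := (ratInclusion k C K m).2

theorem subι_injective (K : Submodule (DualAlg k C) M.carrier) :
    Function.Injective (lin (subι K)) :=
  Subtype.val_injective.comp ratInclusion_injective

/-- Restriction of the codomain of a morphism to a subcomodule. -/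
def subLift (K : Submodule (DualAlg k C) M.carrier) (g : N ⟶ M) (h : ∀ n, lin g n ∈ K) :
    N ⟶ sub K :=
  toRatComod ((dualLin g).codRestrict K h)

theorem subLift_subι (K : Submodule (DualAlg k C) M.carrier) (g : N ⟶ M)
    (h : ∀ n, lin g n ∈ K) : subLift K g h ≫ subι K = g := by
  ext n; rfl

/-- The quotient comodule by a `C^*`-submodule. -/
def quotπ (K : Submodule (DualAlg k C) M.carrier) : M ⟶ ratComod k C (M.carrier ⧸ K) :=
  toRatComod K.mkQ

theorem mono_of_injective (g : M ⟶ N) (h : Function.Injective (lin g)) : Mono g where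
  right_cancellation a b hab := by
    ext x
    refine h ?_
    exact LinearMap.congr_fun (congrArg lin hab) x

theorem epi_of_surjective (g : M ⟶ N) (h : Function.Surjective (lin g)) : Epi g where
  left_cancellation a b hab := by
    ext x
    obtain ⟨x, rfl⟩ := h x
    exact LinearMap.congr_fun (congrArg lin hab) x

theorem injective_of_mono (g : M ⟶ N) [Mono g] : Function.Injective (lin g) := by
  refine (injective_iff_map_eq_zero (lin g)).2 fun m hm => ?_
  let K := LinearMap.ker (dualLin g)
  have h : subι K ≫ g = 0 ≫ g := by
    ext x
    change lin g (lin (subι K) x) = lin g 0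
    rw [map_zero]
    exact subι_mem K x
  have h2 := (cancel_mono g).1 h
  exact LinearMap.congr_fun (congrArg lin h2) (subMk K ⟨m, hm⟩)

theorem surjective_of_epi (g : M ⟶ N) [Epi g] : Function.Surjective (lin g) := by
  intro n
  let K := LinearMap.range (dualLin g)
  have h : g ≫ quotπ K = g ≫ 0 := by
    ext x
    refine ratInclusion_injective (N := N.carrier ⧸ K) ?_
    change K.mkQ (lin g x) = 0
    exact (Submodule.Quotient.mk_eq_zero K).2 ⟨x, rfl⟩
  have h2 := (cancel_epi g).1 h
  have h3 : K.mkQ n = 0 :=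
    congrArg (ratInclusion k C _) (LinearMap.congr_fun (congrArg lin h2) n)
  exact (Submodule.Quotient.mk_eq_zero K).1 h3

theorem isIso_of_bijective (g : M ⟶ N) (h : Function.Bijective (lin g)) : IsIso g := by
  let e := LinearEquiv.ofBijective (dualLin g) h
  refine ⟨ofDualLin e.symm.toLinearMap, ?_, ?_⟩
  · ext x; exact e.symm_apply_apply x
  · ext x; exact e.apply_symm_apply x

end Comod

end Basics

/-! ### The adjunction between the two Nakayama functors -/

section NakayamaAdjunction

variable {k : Type u} {C : Type v} [Field k] [AddCommGroup C] [Module k C] [Coalgebra k C]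

/-- The linear map out of `C ⊗_{C^*} M` given by a balanced bilinear map. -/
def balancedLift {M : Comod k C} {V : Type*} [AddCommGroup V] [Module k V]
    (T : C →ₗ[k] M.carrier →ₗ[k] V)
    (hT : ∀ (f : DualAlg k C) c m, T (coalgActR k f c) m = T c (f • m)) :
    BalancedTensor M →ₗ[k] V :=
  (balancedRel M).liftQ (TensorProduct.lift T) (by
    refine Submodule.span_le.2 ?_
    rintro _ ⟨f, c, m, rfl⟩
    rw [SetLike.mem_coe, LinearMap.mem_ker, map_sub, TensorProduct.lift.tmul,
      TensorProduct.lift.tmul, hT, Comod.smul_def, sub_self])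

theorem balancedTensor_induction {M : Comod k C} {p : BalancedTensor M → Prop}
    (t : BalancedTensor M) (zero : p 0) (tmul : ∀ c m, p (balancedTmul M m c))
    (add : ∀ s t, p s → p t → p (s + t)) : p t := by
  obtain ⟨t, rfl⟩ := (balancedRel M).mkQ_surjective t
  induction t with
  | zero => simpa using zero
  | tmul c m => exact tmul c m
  | add x y hx hy => rw [map_add]; exact add _ _ hx hy

theorem balancedTmul_add (M : Comod k C) (m n : M.carrier) :
    balancedTmul M (m + n) = balancedTmul M m + balancedTmul M n := by
  simp [balancedTmul, LinearMap.comp_add]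

theorem balancedTmul_smul (M : Comod k C) (a : k) (m : M.carrier) :
    balancedTmul M (a • m) = a • balancedTmul M m := by
  simp [balancedTmul, LinearMap.comp_smul]

theorem balancedTmul_zero (M : Comod k C) : balancedTmul M 0 = 0 := by
  simp [balancedTmul]

/-- The colinear map `c ↦ c ⊗_{C^*} m`. -/
def tmulHom (M : Comod k C) (m : M.carrier) : HomReg (nakRObj k C M) :=
  HomReg.ofLin (M := nakRObj k C M) (balancedTmul M m) (balancedCoact_comp M m)

/-- `m ↦ (c ↦ c ⊗_{C^*} m)` as a `C^*`-linear map. -/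
def tmulHomLin (M : Comod k C) : M.carrier →ₗ[DualAlg k C] HomReg (nakRObj k C M) where
  toFun := tmulHom M
  map_add' m n := HomReg.lin_injective _ (balancedTmul_add M m n)
  map_smul' f m := HomReg.lin_injective _ (balancedTmul_act M f m)

theorem smul_balancedTmul (M : Comod k C) (f : DualAlg k C) (c : C) (m : M.carrier) :
    (show (nakRObj k C M).carrier from f • (show (nakRObj k C M).carrier from
      balancedTmul M m c)) = balancedTmul M m (coalgActL k f c) :=
  (Comod.lin_smul (M := regularComod k C) (N := nakRObj k C M) (tmulHom M m) f c).symm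

/-- Evaluation `C ⊗_{C^*} Hom^C(C, M)^rat → M`. -/
def evalLin (M : Comod k C) : BalancedTensor (ratComod k C (HomReg M)) →ₗ[k] M.carrier :=
  balancedLift (M := ratComod k C (HomReg M))
    (LinearMap.mk₂ k (fun c φ => HomReg.lin (ratInclusion k C (HomReg M) φ) c)
      (fun c d φ => map_add _ c d) (fun a c φ => map_smul _ a c)
      (fun c φ ψ => rfl) (fun a c φ => rfl))
    (fun f c φ => by
      change _ = HomReg.lin (ratInclusion k C (HomReg M) (f • φ)) c
      rw [map_smul]
      rfl)

/-- Evaluation `C ⊗_{C^*} Hom^C(C, M)^rat → M` as a morphism of comodules. -/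
def evalHom (M : Comod k C) : nakRObj k C (ratComod k C (HomReg M)) ⟶ M :=
  Comod.ofDualLin
    { toFun := evalLin M
      map_add' := map_add _
      map_smul' := fun f t => by
        refine balancedTensor_induction (M := ratComod k C (HomReg M))
          (p := fun t => evalLin M (show (nakRObj k C (ratComod k C (HomReg M))).carrier from
            f • (show (nakRObj k C (ratComod k C (HomReg M))).carrier from t)) = f • evalLin M t)
          t ?_ (fun c φ => ?_) fun s t hs ht => ?_
        · change evalLin M (f • (0 : (nakRObj k C (ratComod k C (HomReg M))).carrier)) =
            f • evalLin M 0
          rw [smul_zero, map_zero, smul_zero]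
          exact map_zero (evalLin M)
        · refine (congrArg (evalLin M) (smul_balancedTmul _ f c φ)).trans ?_
          exact Comod.lin_smul (M := regularComod k C) (ratInclusion k C (HomReg M) φ) f c
        · rw [map_add, smul_add, ← hs, ← ht]
          exact (congrArg (evalLin M) (smul_add (A := (nakRObj k C _).carrier) f s t)).trans
            (map_add (evalLin M) _ _) }

variable (k C) in
/-- The right exact Nakayama functor is left adjoint to the left exact one. -/
def nakAdjunction : nakR k C ⊣ nakL k C where
  unit :=
    { app := fun M => toRatComod (tmulHomLin M)
      naturality := fun M N g => by
        ext m
        exact Subtype.ext (HomReg.lin_injective _ rfl) }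
  counit :=
    { app := fun M => evalHom M
      naturality := fun M N g => by
        ext1
        exact balancedTensor_hom_ext fun φ => rfl }
  left_triangle_components M := by
    ext1
    exact balancedTensor_hom_ext fun m => rfl
  right_triangle_components M := by
    ext φ
    exact Subtype.ext (HomReg.lin_injective _ rfl)

theorem nakAdjunction_unit_app (M : Comod k C) (m : M.carrier) :
    ratInclusion k C (HomReg (nakRObj k C M))
      (Comod.lin ((nakAdjunction k C).unit.app M) m) = tmulHom M m := rfl

end NakayamaAdjunction

/-! ### Balanced bilinear forms -/

section BalancedForms

variable {k : Type u} {C : Type v} [Field k] [AddCommGroup C] [Module k C] [Coalgebra k C]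

theorem convMul_eq_comp_coalgActL (f g : DualAlg k C) :
    (f * g).ofConv = f.ofConv ∘ₗ coalgActL k g := by
  ext c
  simp only [coalgActL, LinearMap.comp_apply, LinearEquiv.coe_coe]
  change LinearMap.mul' k k (TensorProduct.map f.ofConv g.ofConv (Coalgebra.comul c)) = _
  generalize (Coalgebra.comul (R := k) c) = t
  induction t with
  | zero => simp
  | add x y hx hy => simp only [hx, hy, map_add]
  | tmul x y => simp [mul_comm]

theorem convMul_apply_left (f g : DualAlg k C) (c : C) :
    (f * g).ofConv c = f.ofConv (coalgActL k g c) :=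
  LinearMap.congr_fun (convMul_eq_comp_coalgActL f g) c

theorem convMul_apply_right (f g : DualAlg k C) (c : C) :
    (f * g).ofConv c = g.ofConv (coalgActR k f c) :=
  LinearMap.congr_fun (convMul_eq_comp_coalgActR f g) c

theorem convOne_ofConv : (1 : DualAlg k C).ofConv = Coalgebra.counit := by ext; rfl

theorem counit_coalgActL (f : DualAlg k C) (c : C) :
    Coalgebra.counit (R := k) (coalgActL k f c) = f.ofConv c := by
  rw [← convOne_ofConv, ← convMul_apply_left, one_mul]

theorem counit_coalgActR (f : DualAlg k C) (c : C) :
    Coalgebra.counit (R := k) (coalgActR k f c) = f.ofConv c := by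
  rw [← convOne_ofConv, ← convMul_apply_right, mul_one]

theorem eq_of_forall_dualAlg {c d : C} (h : ∀ f : DualAlg k C, f.ofConv c = f.ofConv d) :
    c = d := by
  rw [← sub_eq_zero, ← Module.forall_dual_apply_eq_zero_iff k]
  intro f
  rw [map_sub, sub_eq_zero]
  exact h (WithConv.toConv f)

theorem coalgActR_eq_tensorEval (f : DualAlg k C) (c : C) :
    coalgActR k f c = tensorEval f (TensorProduct.comm k C C (Coalgebra.comul c)) := by
  simp only [coalgActR, LinearMap.comp_apply, LinearEquiv.coe_coe]
  generalize (Coalgebra.comul (R := k) c) = t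
  induction t with
  | zero => simp
  | add x y hx hy => simp only [hx, hy, map_add]
  | tmul x y => simp

section Finiteness

variable {N : Type*} [AddCommGroup N] [Module k N]

/-- The values `(id ⊗ f) t` of a tensor `t` lie in a finite-dimensional subspace. -/
theorem exists_finite_forall_tensorEval_mem (t : N ⊗[k] C) :
    ∃ V : Submodule k N, Module.Finite k V ∧ ∀ f : DualAlg k C, tensorEval f t ∈ V := by
  induction t with
  | zero => exact ⟨⊥, inferInstance, fun f => by simp⟩
  | tmul n c =>
    refine ⟨k ∙ n, inferInstance, fun f => ?_⟩
    rw [tensorEval_tmul]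
    exact Submodule.smul_mem _ _ (Submodule.mem_span_singleton_self n)
  | add x y hx hy =>
    obtain ⟨V, _, hV⟩ := hx
    obtain ⟨W, _, hW⟩ := hy
    refine ⟨V ⊔ W, inferInstance, fun f => ?_⟩
    rw [map_add]
    exact Submodule.add_mem_sup (hV f) (hW f)

/-- The value `(id ⊗ f) t` depends only on `f` on a finite-dimensional subspace. -/
theorem exists_finite_tensorEval_congr (t : N ⊗[k] C) :
    ∃ V : Submodule k C, Module.Finite k V ∧ ∀ f g : DualAlg k C,
      (∀ d ∈ V, f.ofConv d = g.ofConv d) → tensorEval f t = tensorEval g t := by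
  induction t with
  | zero => exact ⟨⊥, inferInstance, fun f g _ => by simp⟩
  | tmul n c =>
    refine ⟨k ∙ c, inferInstance, fun f g h => ?_⟩
    rw [tensorEval_tmul, tensorEval_tmul, h c (Submodule.mem_span_singleton_self c)]
  | add x y hx hy =>
    obtain ⟨V, _, hV⟩ := hx
    obtain ⟨W, _, hW⟩ := hy
    refine ⟨V ⊔ W, inferInstance, fun f g h => ?_⟩
    rw [map_add, map_add, hV f g fun d hd => h d (Submodule.mem_sup_left hd),
      hW f g fun d hd => h d (Submodule.mem_sup_right hd)]

end Finiteness

/-- A rational element is fixed by every functional that agrees with the counit on a suitable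
finite-dimensional subspace. -/
theorem exists_finite_smul_eq_self_of_mem_ratPart {N : Type*} [AddCommGroup N] [Module k N]
    [Module (DualAlg k C) N] [IsScalarTower k (DualAlg k C) N] {x : N} (hx : x ∈ ratPart k C N) :
    ∃ V : Submodule k C, Module.Finite k V ∧ ∀ f : DualAlg k C,
      (∀ d ∈ V, f.ofConv d = Coalgebra.counit d) → f • x = x := by
  obtain ⟨t, ht⟩ := hx
  obtain ⟨V, hV, h⟩ := exists_finite_tensorEval_congr t
  refine ⟨V, hV, fun f hf => ?_⟩
  rw [ht, h f 1 fun d hd => by rw [hf d hd, convOne_ofConv], ← ht, one_smul]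

namespace Comod

/-- Every element of a comodule generates a finite-dimensional subcomodule. -/
theorem finite_span_singleton {M : Comod k C} (m : M.carrier) :
    Module.Finite k (Submodule.span (DualAlg k C) {m}) := by
  obtain ⟨V, _, hV⟩ := exists_finite_forall_tensorEval_mem (M.coact m)
  have h : (Submodule.span (DualAlg k C) {m}).restrictScalars k ≤ V := by
    intro x hx
    obtain ⟨f, rfl⟩ := Submodule.mem_span_singleton.1 hx
    exact hV f
  exact Submodule.finiteDimensional_of_le h

theorem exists_finite_smul_eq_self {M : Comod k C} (m : M.carrier) :
    ∃ V : Submodule k C, Module.Finite k V ∧ ∀ f : DualAlg k C,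
      (∀ d ∈ V, f.ofConv d = Coalgebra.counit d) → f • m = m :=
  exists_finite_smul_eq_self_of_mem_ratPart (mem_ratPart m)

end Comod

theorem exists_finite_coalgActR_eq_self (c : C) :
    ∃ V : Submodule k C, Module.Finite k V ∧ ∀ f : DualAlg k C,
      (∀ d ∈ V, f.ofConv d = Coalgebra.counit d) → coalgActR k f c = c := by
  obtain ⟨V, hV, h⟩ := exists_finite_tensorEval_congr
    (TensorProduct.comm k C C (Coalgebra.comul (R := k) c))
  refine ⟨V, hV, fun f hf => ?_⟩
  rw [coalgActR_eq_tensorEval, h f 1 fun d hd => by rw [hf d hd, convOne_ofConv],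
    ← coalgActR_eq_tensorEval, coalgActR_one, LinearMap.id_apply]

variable (k C) in
/-- The bilinear forms `B` on `C` with `B (c ↼ f) d = B c (f ⇀ d)`. The map `d ↦ B (-) d` is then
a homomorphism of left `C^*`-modules `C → C^*`, the map `c ↦ B c` one of right `C^*`-modules, and
every such homomorphism arises in this way. -/
def balancedForms : Submodule k (C →ₗ[k] C →ₗ[k] k) where
  carrier := {B | ∀ (f : DualAlg k C) c d, B (coalgActR k f c) d = B c (coalgActL k f d)}
  zero_mem' f c d := rfl
  add_mem' hB hB' f c d := by
    simp only [LinearMap.add_apply, hB f c d, hB' f c d]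
  smul_mem' a B hB f c d := by
    simp only [LinearMap.smul_apply, hB f c d]

variable (k C) in
/-- The balanced forms separate the elements of `C` in the second variable: `C` is a torsionless
left `C^*`-module. -/
def LeftTorsionless : Prop :=
  ∀ d : C, (∀ B ∈ balancedForms k C, ∀ c, B c d = 0) → d = 0

variable (k C) in
/-- The balanced forms separate the elements of `C` in the first variable: `C` is a torsionless
right `C^*`-module. -/
def RightTorsionless : Prop :=
  ∀ c : C, (∀ B ∈ balancedForms k C, ∀ d, B c d = 0) → c = 0

theorem IsLeftQcF.leftTorsionless (h : IsLeftQcF k C) : LeftTorsionless k C := by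
  obtain ⟨κ, φ, hφ, hlin⟩ := h
  intro d hd
  refine hφ (Finsupp.ext fun i => WithConv.ofConv_injective (LinearMap.ext fun c => ?_))
  rw [map_zero]
  refine hd (((WithConv.linearEquiv k (C →ₗ[k] k)).toLinearMap ∘ₗ Finsupp.lapply i ∘ₗ φ).flip)
    (fun f c d => ?_) c
  change (φ d i).ofConv (coalgActR k f c) = (φ (coalgActL k f d) i).ofConv c
  rw [hlin, Finsupp.smul_apply, smul_eq_mul, convMul_apply_right]

theorem IsRightQcF.rightTorsionless (h : IsRightQcF k C) : RightTorsionless k C := by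
  obtain ⟨κ, φ, hφ, hlin⟩ := h
  intro c hc
  refine hφ (Finsupp.ext fun i => WithConv.ofConv_injective (LinearMap.ext fun d => ?_))
  rw [map_zero]
  refine hc ((WithConv.linearEquiv k (C →ₗ[k] k)).toLinearMap ∘ₗ Finsupp.lapply i ∘ₗ φ)
    (fun f c d => ?_) d
  change (φ (coalgActR k f c) i).ofConv d = (φ c i).ofConv (coalgActL k f d)
  rw [hlin, Finsupp.smul_apply, op_smul_eq_mul, convMul_apply_left]

variable {B : C →ₗ[k] C →ₗ[k] k}

/-- The `C^*`-linear map `d ↦ B (-) d` from `C` to `C^*` given by a balanced form. -/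
def formToDual (hB : B ∈ balancedForms k C) :
    (regularComod k C).carrier →ₗ[DualAlg k C] DualAlg k C where
  toFun d := WithConv.toConv (B.flip d)
  map_add' d d' := by
    exact congrArg WithConv.toConv (map_add B.flip d d')
  map_smul' f d := WithConv.ofConv_injective (LinearMap.ext fun c => by
    rw [RingHom.id_apply, smul_eq_mul, convMul_apply_right]
    exact (hB f c d).symm)

theorem toConv_form_coalgActR (hB : B ∈ balancedForms k C) (f : DualAlg k C) (c : C) :
    WithConv.toConv (B (coalgActR k f c)) = WithConv.toConv (B c) * f :=
  WithConv.ofConv_injective (LinearMap.ext fun d => by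
    rw [convMul_apply_left]
    exact hB f c d)

/-- Acting on `d` by the functional `B c` is the same as acting on `c` by the functional
`B (-) d`. -/
theorem coalgActR_form (hB : B ∈ balancedForms k C) (c d : C) :
    coalgActR k (WithConv.toConv (B c)) d = coalgActL k (WithConv.toConv (B.flip d)) c := by
  refine eq_of_forall_dualAlg (k := k) fun f => ?_
  rw [← convMul_apply_right, ← convMul_apply_left, convMul_apply_left, convMul_apply_right]
  exact (hB f c d).symm

/-- A family of functionals separating the points of a finite-dimensional space spans its dual. -/
theorem exists_sum_eq_of_separating {V ι : Type*} [AddCommGroup V] [Module k V] [Module.Finite k V]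
    (F : ι → Module.Dual k V) (hF : ∀ x, (∀ i, F i x = 0) → x = 0) (g : Module.Dual k V) :
    ∃ (n : ℕ) (a : Fin n → k) (i : Fin n → ι), ∀ x, g x = ∑ j, a j * F (i j) x := by
  have h : Submodule.span k (Set.range F) = ⊤ := by
    rw [← Subspace.dualCoannihilator_dualAnnihilator_eq (W := Submodule.span k (Set.range F))]
    have : (Submodule.span k (Set.range F)).dualCoannihilator = ⊥ := by
      rw [eq_bot_iff]
      intro x hx
      refine hF x fun i => ?_
      exact (Submodule.mem_dualCoannihilator x).1 hx _ (Submodule.subset_span ⟨i, rfl⟩)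
    rw [this, Submodule.dualAnnihilator_bot]
  obtain ⟨n, a, s, hs⟩ := Submodule.mem_span_set'.1 (h.symm ▸ Submodule.mem_top : g ∈ _)
  choose i hi using fun j => (s j).2
  refine ⟨n, a, i, fun x => ?_⟩
  rw [← hs, LinearMap.sum_apply]
  exact Finset.sum_congr rfl fun j _ => by rw [LinearMap.smul_apply, smul_eq_mul, hi]

/-- If `C` is a torsionless left `C^*`-module, then on a finite-dimensional subspace the counit is
a combination of the functionals `B c`. -/
theorem LeftTorsionless.exists_counit_eq (h : LeftTorsionless k C) (V : Submodule k C)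
    [Module.Finite k V] : ∃ (n : ℕ) (B : Fin n → balancedForms k C) (c : Fin n → C),
      ∀ d ∈ V, Coalgebra.counit (R := k) d = ∑ i, (B i).1 (c i) d := by
  obtain ⟨n, a, i, hi⟩ := exists_sum_eq_of_separating
    (fun p : balancedForms k C × C => (p.1.1 p.2) ∘ₗ V.subtype)
    (fun x hx => Subtype.ext (h x fun B hB c => hx (⟨B, hB⟩, c)))
    ((Coalgebra.counit (R := k) (A := C)) ∘ₗ V.subtype)
  refine ⟨n, fun j => (i j).1, fun j => a j • (i j).2, fun d hd => (hi ⟨d, hd⟩).trans ?_⟩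
  exact Finset.sum_congr rfl fun j _ => by
    rw [map_smul, LinearMap.smul_apply, smul_eq_mul]; rfl

/-- If `C` is a torsionless right `C^*`-module, then on a finite-dimensional subspace the counit is
a combination of the functionals `B (-) d`. -/
theorem RightTorsionless.exists_counit_eq (h : RightTorsionless k C) (V : Submodule k C)
    [Module.Finite k V] : ∃ (n : ℕ) (B : Fin n → balancedForms k C) (d : Fin n → C),
      ∀ c ∈ V, Coalgebra.counit (R := k) c = ∑ i, (B i).1 c (d i) := by
  obtain ⟨n, a, i, hi⟩ := exists_sum_eq_of_separating
    (fun p : balancedForms k C × C => (p.1.1.flip p.2) ∘ₗ V.subtype)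
    (fun x hx => Subtype.ext (h x fun B hB d => hx (⟨B, hB⟩, d)))
    ((Coalgebra.counit (R := k) (A := C)) ∘ₗ V.subtype)
  refine ⟨n, fun j => (i j).1, fun j => a j • (i j).2, fun d hd => (hi ⟨d, hd⟩).trans ?_⟩
  exact Finset.sum_congr rfl fun j _ => by
    rw [map_smul, smul_eq_mul]; rfl

end BalancedForms

/-! ### Local units and dual bases -/

section LocalUnits

variable {k : Type u} {C : Type v} [Field k] [AddCommGroup C] [Module k C] [Coalgebra k C]

theorem coalgActR_sum {n : ℕ} (f : Fin n → DualAlg k C) (c : C) :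
    coalgActR k (∑ i, f i) c = ∑ i, coalgActR k (f i) c := by
  let T : DualAlg k C →+ (C →ₗ[k] C) := ⟨⟨coalgActR k, coalgActR_zero⟩, coalgActR_add⟩
  have h : coalgActR k (∑ i, f i) = ∑ i, coalgActR k (f i) := map_sum T f Finset.univ
  rw [h, LinearMap.sum_apply]

/-- The right action of a functional, as an endomorphism of the left `C^*`-module `C`. -/
def coalgActREnd (f : DualAlg k C) :
    (regularComod k C).carrier →ₗ[DualAlg k C] (regularComod k C).carrier :=
  Comod.dualLin (M := regularComod k C) (N := regularComod k C)
    (Comod.ofLin (M := regularComod k C) (N := regularComod k C) (coalgActR (C := C) k f)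
      (comul_coalgActR f))

variable (k C) in
/-- The counit, as a linear form on the regular comodule. -/
def regularCounit : (regularComod k C).carrier →ₗ[k] k := Coalgebra.counit (R := k) (A := C)

theorem regularCounit_smul (f : DualAlg k C) (c : (regularComod k C).carrier) :
    regularCounit k C (f • c) = f.ofConv c := counit_coalgActL f c

/-- A homomorphism of comodules into `C` is determined by its composition with the counit. -/
theorem eq_of_counit_eq {M : Comod k C}
    {g h : M.carrier →ₗ[DualAlg k C] (regularComod k C).carrier}
    (H : ∀ m, regularCounit k C (g m) = regularCounit k C (h m)) : g = h := by
  refine LinearMap.ext fun m => eq_of_forall_dualAlg (k := k) (C := C) fun f => ?_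
  have h1 := H (f • m)
  rwa [g.map_smul, h.map_smul, regularCounit_smul, regularCounit_smul] at h1

/-- The functional `ε ∘ g` of an endomorphism `g` of the left `C^*`-module `C`. -/
def endFunctional
    (g : (regularComod k C).carrier →ₗ[DualAlg k C] (regularComod k C).carrier) : DualAlg k C :=
  WithConv.toConv (A := C →ₗ[k] k) (regularCounit k C ∘ₗ g.restrictScalars k)

/-- Every endomorphism of the left `C^*`-module `C` is the right action of a functional. -/
theorem eq_coalgActREnd
    (g : (regularComod k C).carrier →ₗ[DualAlg k C] (regularComod k C).carrier) :
    g = coalgActREnd (endFunctional g) :=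
  eq_of_counit_eq (M := regularComod k C) fun m => (counit_coalgActR (endFunctional g) m).symm

/-- If `C` is a torsionless left `C^*`-module, then every finite-dimensional subspace has a local
unit whose right action on `C` has finite rank, since `d ↼ B c = B (-) d ⇀ c` is a contraction of
`Δ c`. -/
theorem LeftTorsionless.exists_finite_range (h : LeftTorsionless k C) (V : Submodule k C)
    [Module.Finite k V] : ∃ f : DualAlg k C, (∀ d ∈ V, f.ofConv d = Coalgebra.counit d) ∧
      Module.Finite k (LinearMap.range (coalgActR k f)) := by
  obtain ⟨n, B, c, hB⟩ := h.exists_counit_eq V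
  refine ⟨∑ i, WithConv.toConv ((B i).1 (c i)), fun d hd => ?_, ?_⟩
  · rw [hB d hd, WithConv.ofConv_sum, LinearMap.sum_apply]
  · choose W hW hcW using fun i => exists_finite_forall_tensorEval_mem
      (Coalgebra.comul (R := k) (c i))
    refine Submodule.finiteDimensional_of_le (S₂ := ⨆ i, W i) ?_
    rintro _ ⟨d, rfl⟩
    rw [coalgActR_sum]
    refine Submodule.sum_mem _ fun i _ => Submodule.mem_iSup_of_mem i ?_
    rw [coalgActR_form (B i).2]
    exact hcW i _

/-- On a finite-dimensional submodule of a torsionless left `C^*`-module `C`, the identity is a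
combination of homomorphisms that factor through `C^*`. -/
theorem LeftTorsionless.exists_dual_basis (h : LeftTorsionless k C)
    (K : Submodule (DualAlg k C) (regularComod k C).carrier) [Module.Finite k K] :
    ∃ (n : ℕ) (B : Fin n → balancedForms k C) (c : Fin n → (regularComod k C).carrier),
      ∀ d ∈ K, d = ∑ i, (formToDual (B i).2 d) • c i := by
  let K' : Submodule k C := K.restrictScalars k
  have : Module.Finite k K' := ‹Module.Finite k K›
  obtain ⟨n, B, c, hB⟩ := h.exists_counit_eq K'
  refine ⟨n, B, c, fun d hd => eq_of_forall_dualAlg (k := k) (C := C) fun f => ?_⟩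
  have h1 : f.ofConv d = ∑ i, (B i).1 (c i) (coalgActL k f d) :=
    (counit_coalgActL (C := C) f d).symm.trans (hB _ (K.smul_mem f hd))
  rw [h1]
  refine Eq.trans ?_ (map_sum f.ofConv _ _).symm
  refine Finset.sum_congr rfl fun i _ => ?_
  refine Eq.trans ?_ (convMul_apply_left f (formToDual (B i).2 d) (c i))
  exact congrArg (fun g : DualAlg k C => g.ofConv (c i)) ((formToDual (B i).2).map_smul f d)

/-! ### Invertibility of the Nakayama functors -/

/-- The map `c ⊗ m ↦ ⟨B c, -⟩ m` on `C ⊗_{C^*} M`. -/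
def formContract {B : C →ₗ[k] C →ₗ[k] k} (hB : B ∈ balancedForms k C) (M : Comod k C) :
    BalancedTensor M →ₗ[k] M.carrier :=
  balancedLift
    (LinearMap.mk₂ k (fun c m => (WithConv.toConv (B c) : DualAlg k C) • m)
      (fun c d m => by rw [map_add, WithConv.toConv_add, add_smul])
      (fun a c m => by rw [map_smul, WithConv.toConv_smul, smul_assoc])
      (fun c m n => smul_add _ m n) (fun a c m => smul_comm _ a m))
    (fun f c m => by
      rw [LinearMap.mk₂_apply, LinearMap.mk₂_apply, toConv_form_coalgActR hB, mul_smul])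

theorem formContract_tmul {B : C →ₗ[k] C →ₗ[k] k} (hB : B ∈ balancedForms k C) (M : Comod k C)
    (c : C) (m : M.carrier) :
    formContract hB M (balancedTmul M m c) = (WithConv.toConv (B c) : DualAlg k C) • m := rfl

/-- An element `m` is fixed by a local unit, a sum of functionals `B c`, and `B c ⇀ m` is
determined by `c ⊗ m`. -/
theorem LeftTorsionless.eq_zero_of_balancedTmul_eq_zero (h : LeftTorsionless k C) {M : Comod k C}
    {m : M.carrier} (hm : balancedTmul M m = 0) : m = 0 := by
  obtain ⟨V, _, hV⟩ := Comod.exists_finite_smul_eq_self m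
  obtain ⟨n, B, c, hB⟩ := h.exists_counit_eq V
  rw [← hV (∑ i, WithConv.toConv ((B i).1 (c i))) fun d hd => by
    rw [hB d hd, WithConv.ofConv_sum, LinearMap.sum_apply], Finset.sum_smul]
  refine Finset.sum_eq_zero fun i _ => ?_
  rw [← formContract_tmul (B i).2, hm, LinearMap.zero_apply, map_zero]

/-- The rational homomorphisms `C → C ⊗_{C^*} M` are the maps `c ↦ c ⊗ m`. -/
theorem LeftTorsionless.exists_eq_tmulHom (h : LeftTorsionless k C) {M : Comod k C}
    (φ : HomReg (nakRObj k C M)) (hφ : φ ∈ ratPart k C (HomReg (nakRObj k C M))) :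
    ∃ m, φ = tmulHom M m := by
  obtain ⟨V, _, hV⟩ := exists_finite_smul_eq_self_of_mem_ratPart hφ
  obtain ⟨f, hf, hfin⟩ := h.exists_finite_range V
  have hφf : ∀ c, HomReg.lin φ (coalgActR k f c) = HomReg.lin φ c := fun c =>
    LinearMap.congr_fun (congrArg HomReg.lin (hV f hf)) c
  -- `φ` factors through the finite-dimensional submodule `C ↼ f`, which has a dual basis
  have : Module.Finite k (LinearMap.range (coalgActREnd f)) := hfin
  obtain ⟨n, B, c, hB⟩ := h.exists_dual_basis (LinearMap.range (coalgActREnd f))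
  -- Every homomorphism `C → C^*`, followed by evaluation at an element `t`, is `c ↦ c ⊗ m`
  have key : ∀ (i : Fin n) (t : BalancedTensor M), ∃ m : M.carrier, ∀ c : C,
      (nakRObj k C M).act (formToDual (B i).2 (coalgActR k f c)) t = balancedTmul M m c := by
    intro i t
    refine balancedTensor_induction (M := M) (p := fun t => ∃ m : M.carrier, ∀ c : C,
      (nakRObj k C M).act (formToDual (B i).2 (coalgActR k f c)) t = balancedTmul M m c) t
      ⟨0, fun c => ?_⟩ (fun c' m => ?_) ?_
    · rw [balancedTmul_zero]
      exact map_zero _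
    · let g := (LinearMap.toSpanSingleton (DualAlg k C) (regularComod k C).carrier c') ∘ₗ
        formToDual (B i).2 ∘ₗ coalgActREnd f
      refine ⟨endFunctional g • m, fun c => ?_⟩
      refine (smul_balancedTmul M _ c' m).trans ?_
      refine Eq.trans ?_ (LinearMap.congr_fun (balancedTmul_act M _ m) c).symm
      exact congrArg (balancedTmul M m) (LinearMap.congr_fun (eq_coalgActREnd g) c)
    · rintro s t ⟨m, hm⟩ ⟨m', hm'⟩
      refine ⟨m + m', fun c => ?_⟩
      rw [balancedTmul_add, LinearMap.add_apply, ← hm, ← hm']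
      exact map_add _ _ _
  choose m hm using fun i => key i (HomReg.lin φ (c i))
  refine ⟨∑ i, m i, HomReg.lin_injective _ (LinearMap.ext fun d => ?_)⟩
  have h1 : balancedTmul M (∑ i, m i) d = ∑ i, balancedTmul M (m i) d := by
    simp only [balancedTmul, LinearMap.comp_apply, map_sum, LinearMap.sum_apply]
  refine Eq.trans ?_ h1.symm
  rw [← hφf d]
  have h2 := congrArg (Comod.dualLin (M := regularComod k C) (N := nakRObj k C M) φ)
    (hB (coalgActREnd f d) ⟨d, rfl⟩)
  rw [map_sum] at h2
  refine h2.trans (Finset.sum_congr rfl fun i _ => ?_)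
  rw [map_smul]
  exact hm i d

theorem LeftTorsionless.isIso_unit (h : LeftTorsionless k C) (M : Comod k C) :
    IsIso ((nakAdjunction k C).unit.app M) := by
  refine Comod.isIso_of_bijective _ ⟨?_, ?_⟩
  · refine (injective_iff_map_eq_zero _).2 fun m hm => h.eq_zero_of_balancedTmul_eq_zero ?_
    have := nakAdjunction_unit_app M m
    rw [hm] at this
    exact (congrArg HomReg.lin this).symm
  · intro φ
    obtain ⟨m, hm⟩ := h.exists_eq_tmulHom (M := M)
      (ratInclusion k C (HomReg (nakRObj k C M)) φ) (Subtype.property φ)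
    exact ⟨m, ratInclusion_injective hm.symm⟩

/-- If `C` is a torsionless right `C^*`-module, then every element `m` of a comodule `M` is a value
of the evaluation map of the adjunction. The homomorphisms `φ i : C → M` used for it factor through
the submodule generated by `m`, so they vanish after any homomorphism that kills `m`. -/
theorem RightTorsionless.exists_eval_eq (h : RightTorsionless k C) {M : Comod k C}
    (m : M.carrier) : ∃ (n : ℕ) (d : Fin n → C) (φ : Fin n → (ratComod k C (HomReg M)).carrier),
      Comod.lin ((nakAdjunction k C).counit.app M) (∑ i, balancedTmul _ (φ i) (d i)) = m ∧
      ∀ (N : Comod k C) (g : M ⟶ N), Comod.lin g m = 0 →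
        ∀ i, Comod.lin ((nakL k C).map g) (φ i) = 0 := by
  obtain ⟨V, _, hV⟩ := Comod.exists_finite_smul_eq_self m
  obtain ⟨n, B, d, hB⟩ := h.exists_counit_eq V
  -- a functional `f` fixing the finitely many elements `d i`; being a sum of values of homomorphisms
  -- `C → C^*`, it is a rational element of `C^*`, which makes the homomorphisms `f • ψ` rational
  choose W hW hdW using fun i => exists_finite_coalgActR_eq_self (k := k) (d i)
  obtain ⟨n', B', d', hB'⟩ := h.exists_counit_eq (⨆ i, W i)
  set f : DualAlg k C := ∑ j, formToDual (B' j).2 (d' j) with hf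
  have hfd : ∀ i, coalgActR k f (d i) = d i := fun i => hdW i f fun c hc => by
    rw [hB' c (Submodule.mem_iSup_of_mem i hc), hf, WithConv.ofConv_sum, LinearMap.sum_apply]
    rfl
  let ψ : Fin n → HomReg M := fun i => Comod.ofDualLin (M := regularComod k C)
    (LinearMap.toSpanSingleton (DualAlg k C) M.carrier m ∘ₗ formToDual (B i).2)
  have hψ : ∀ i, f • ψ i ∈ ratPart k C (HomReg M) := fun i => by
    rw [hf, Finset.sum_smul]
    refine Submodule.sum_mem _ fun j _ => ?_
    let g := LinearMap.toSpanSingleton (DualAlg k C) (HomReg M) (ψ i) ∘ₗ formToDual (B' j).2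
    exact map_mem_ratPart (g.restrictScalars k) g.map_smul _
      (Comod.mem_ratPart (M := regularComod k C) (d' j))
  refine ⟨n, d, fun i => (⟨f • ψ i, hψ i⟩ : ratPart k C (HomReg M)), ?_, fun N g hg i => ?_⟩
  · refine (map_sum _ _ _).trans ?_
    have h1 : ∀ i, HomReg.lin (f • ψ i) (d i) = formToDual (B i).2 (d i) • m := fun i => by
      rw [HomReg.lin_dual_smul, LinearMap.comp_apply, hfd]
      rfl
    refine (Finset.sum_congr rfl fun i _ => h1 i).trans ?_
    rw [← Finset.sum_smul]
    refine hV _ fun c hc => ?_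
    rw [hB c hc, WithConv.ofConv_sum, LinearMap.sum_apply]
    rfl
  · refine Subtype.ext (HomReg.lin_injective _ (LinearMap.ext fun c => ?_))
    change Comod.lin g (formToDual (B i).2 (coalgActR k f c) • m) = 0
    rw [Comod.lin_smul, hg, smul_zero]

/-- The functor `Hom^C(C, -)^rat` turns the counit into an isomorphism by the triangle identity, so
the homomorphisms that represent an element of the kernel of the counit vanish. -/
theorem isIso_counit (hl : LeftTorsionless k C) (hr : RightTorsionless k C) (M : Comod k C) :
    IsIso ((nakAdjunction k C).counit.app M) := by
  have h1 : IsIso ((nakL k C).map ((nakAdjunction k C).counit.app M)) := by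
    have := hl.isIso_unit ((nakL k C).obj M)
    exact IsIso.of_isIso_fac_left ((nakAdjunction k C).right_triangle_components M)
  refine Comod.isIso_of_bijective _ ⟨?_, fun m => ?_⟩
  · refine (injective_iff_map_eq_zero _).2 fun t ht => ?_
    obtain ⟨n, d, φ, hsum, hφ⟩ := hr.exists_eval_eq t
    have h2 : ∀ i, φ i = 0 := fun i =>
      Comod.injective_of_mono ((nakL k C).map ((nakAdjunction k C).counit.app M))
        ((hφ _ _ ht i).trans (map_zero _).symm)
    rw [← hsum]
    have h3 : ∀ i, balancedTmul _ (φ i) (d i) = 0 := fun i => by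
      rw [h2, balancedTmul_zero, LinearMap.zero_apply]
    exact (congrArg _ (Finset.sum_eq_zero fun i _ => h3 i)).trans (map_zero (Comod.lin _))
  · obtain ⟨n, d, φ, hsum, -⟩ := hr.exists_eval_eq m
    exact ⟨_, hsum⟩

theorem nakR_isEquivalence (hl : LeftTorsionless k C) (hr : RightTorsionless k C) :
    (nakR k C).IsEquivalence := by
  have := hl.isIso_unit
  have := isIso_counit hl hr
  exact (nakAdjunction k C).toEquivalence.isEquivalence_functor

end LocalUnits

/-! ### Exactness and faithfulness of the right exact Nakayama functor -/

section ExactFaithful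

universe w

variable {k : Type u} {C : Type v} [Field k] [AddCommGroup C] [Module k C] [Coalgebra k C]

/-- Linear forms on `C ⊗_{C^*} C` are balanced bilinear forms. -/
theorem mem_balancedForms_of_dual (l : BalancedTensor (regularComod k C) →ₗ[k] k) :
    LinearMap.mk₂ k (fun c d => l (balancedTmul (regularComod k C) d c))
      (fun c c' d => by rw [map_add, map_add]) (fun a c d => by rw [map_smul, map_smul])
      (fun c d d' => by rw [← map_add]; exact congrArg (fun g => l (g c)) (balancedTmul_add _ d d'))
      (fun a c d => by
        rw [← map_smul]; exact congrArg (fun g => l (g c)) (balancedTmul_smul _ a d)) ∈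
      balancedForms k C := fun f c d =>
  congrArg l (LinearMap.congr_fun (balancedTmul_act (regularComod k C) f d) c).symm

theorem balancedTmul_eq_zero_of_forms {c d : C} (h : ∀ B ∈ balancedForms k C, B c d = 0) :
    balancedTmul (regularComod k C) d c = 0 :=
  (Module.forall_dual_apply_eq_zero_iff k _).1 fun l => h _ (mem_balancedForms_of_dual l)

theorem balancedTmul_smul_dual (M : Comod k C) (f : DualAlg k C) (m : M.carrier) (c : C) :
    balancedTmul M (f • m) c = balancedTmul M m (coalgActR k f c) :=
  LinearMap.congr_fun (balancedTmul_act M f m) c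

theorem nakR_map_tmul {M N : Comod k C} (g : M ⟶ N) (m : M.carrier) (c : C) :
    Comod.lin ((nakR k C).map g) (balancedTmul M m c) = balancedTmul N (Comod.lin g m) c := rfl

/-- An element `d` killed by all balanced forms satisfies `c ⊗ d = 0` for all `c`, so the inclusion
of the submodule generated by `d` is sent to zero. -/
theorem leftTorsionless_of_faithful [(nakR k C).Faithful] : LeftTorsionless k C := by
  intro (d : (regularComod k C).carrier) hd
  let K : Submodule (DualAlg k C) (regularComod k C).carrier := Submodule.span _ {d}
  have h : (nakR k C).map (Comod.subι K) = (nakR k C).map 0 := by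
    ext1
    refine balancedTensor_hom_ext fun x => LinearMap.ext fun c => ?_
    refine (nakR_map_tmul (Comod.subι K) x c).trans
      (Eq.trans ?_ (nakR_map_tmul (0 : Comod.sub K ⟶ _) x c).symm)
    obtain ⟨f, hf⟩ := Submodule.mem_span_singleton.1 (Comod.subι_mem K x)
    rw [← hf]
    refine (balancedTmul_smul_dual _ f d c).trans ?_
    rw [balancedTmul_eq_zero_of_forms fun B hB => hd B hB _]
    exact (LinearMap.congr_fun (balancedTmul_zero _) c).symm
  have h1 := (nakR k C).map_injective h
  exact LinearMap.congr_fun (congrArg Comod.lin h1)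
    (Comod.subMk K ⟨d, Submodule.mem_span_singleton_self d⟩)

section HomFinite

variable {Y : Type w} [AddCommGroup Y] [Module k Y] [Module (DualAlg k C) Y]
  [IsScalarTower k (DualAlg k C) Y]

theorem finite_hom_of_finite (P : Type*) [AddCommGroup P] [Module k P] [Module (DualAlg k C) P]
    [IsScalarTower k (DualAlg k C) P] [Module.Finite k P] [Module.Finite k Y] :
    Module.Finite k (P →ₗ[DualAlg k C] Y) :=
  Module.Finite.of_injective
    ({ toFun := fun g => g.restrictScalars k
       map_add' := fun _ _ => rfl
       map_smul' := fun _ _ => rfl } : (P →ₗ[DualAlg k C] Y) →ₗ[k] (P →ₗ[k] Y))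
    fun _ _ hab => LinearMap.ext fun x => LinearMap.congr_fun hab x

theorem finite_hom_to_regular (P : Type*) [AddCommGroup P] [Module k P] [Module (DualAlg k C) P]
    [IsScalarTower k (DualAlg k C) P] [Module.Finite k P] :
    Module.Finite k (P →ₗ[DualAlg k C] (regularComod k C).carrier) := by
  let T : (P →ₗ[DualAlg k C] (regularComod k C).carrier) →ₗ[k] Module.Dual k P :=
    { toFun := fun g => regularCounit k C ∘ₗ g.restrictScalars k
      map_add' := fun a b => LinearMap.ext fun x => map_add (regularCounit k C) _ _
      map_smul' := fun a b => LinearMap.ext fun x => map_smul (regularCounit k C) _ _ }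
  refine Module.Finite.of_injective T fun a b hab => LinearMap.ext fun x => ?_
  refine eq_of_forall_dualAlg (k := k) (C := C) fun f => ?_
  have h1 := LinearMap.congr_fun hab (f • x)
  change regularCounit k C (a (f • x)) = regularCounit k C (b (f • x)) at h1
  rwa [a.map_smul, b.map_smul, regularCounit_smul, regularCounit_smul] at h1

theorem finite_hom_of_exact (P : Type*) [AddCommGroup P] [Module (DualAlg k C) P]
    {Y₁ Y₂ : Type*} [AddCommGroup Y₁] [Module k Y₁]
    [Module (DualAlg k C) Y₁] [IsScalarTower k (DualAlg k C) Y₁] [AddCommGroup Y₂] [Module k Y₂]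
    [Module (DualAlg k C) Y₂] [IsScalarTower k (DualAlg k C) Y₂] (i : Y₁ →ₗ[DualAlg k C] Y)
    (q : Y →ₗ[DualAlg k C] Y₂) (hi : Function.Injective i) (hq : Function.Exact i q)
    [Module.Finite k (P →ₗ[DualAlg k C] Y₁)] [Module.Finite k (P →ₗ[DualAlg k C] Y₂)] :
    Module.Finite k (P →ₗ[DualAlg k C] Y) := by
  have : IsNoetherian k (P →ₗ[DualAlg k C] Y) := by
    refine isNoetherian_of_range_eq_ker (LinearMap.compRight k (M := P) i)
      (LinearMap.compRight k (M := P) q) (le_antisymm ?_ fun g hg => ?_)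
    · rintro _ ⟨g, rfl⟩
      exact LinearMap.ext fun x => hq.apply_apply_eq_zero (g x)
    have h : ∀ x, g x ∈ LinearMap.range i := fun x => (hq (g x)).1 (LinearMap.congr_fun hg x)
    refine ⟨(LinearEquiv.ofInjective i hi).symm.toLinearMap ∘ₗ g.codRestrict _ h,
      LinearMap.ext fun x => ?_⟩
    exact congrArg Subtype.val ((LinearEquiv.ofInjective i hi).apply_symm_apply ⟨g x, h x⟩)
  infer_instance

/-- If `C` is a torsionless left `C^*`-module, then a simple finite-dimensional `C^*`-module admits
only finitely many independent homomorphisms from `C`: these are detected by composition with the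
homomorphisms to `C` from a fixed finite-dimensional submodule. -/
theorem LeftTorsionless.finite_hom_of_simple (h : LeftTorsionless k C) [Module.Finite k Y]
    (hY : ∀ K : Submodule (DualAlg k C) Y, K = ⊥ ∨ K = ⊤) :
    Module.Finite k ((regularComod k C).carrier →ₗ[DualAlg k C] Y) := by
  by_cases h0 : ∀ g : (regularComod k C).carrier →ₗ[DualAlg k C] Y, g = 0
  · have : Subsingleton ((regularComod k C).carrier →ₗ[DualAlg k C] Y) :=
      ⟨fun a b => (h0 a).trans (h0 b).symm⟩
    infer_instance
  push Not at h0
  obtain ⟨g₀, hg₀⟩ := h0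
  obtain ⟨c₀, hc₀⟩ : ∃ c, g₀ c ≠ 0 := by
    by_contra! H
    exact hg₀ (LinearMap.ext H)
  let V := Submodule.span (DualAlg k C) {c₀}
  have hV : Module.Finite k V := Comod.finite_span_singleton c₀
  obtain ⟨n, B, c, hB⟩ := h.exists_dual_basis V
  have fin1 : Module.Finite k (V →ₗ[DualAlg k C] (regularComod k C).carrier) :=
    finite_hom_to_regular V
  have fin2 : Module.Finite k (V →ₗ[DualAlg k C] Y) := finite_hom_of_finite V
  let Φ : ((regularComod k C).carrier →ₗ[DualAlg k C] Y) →ₗ[k]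
      (V →ₗ[DualAlg k C] (regularComod k C).carrier) →ₗ[k] (V →ₗ[DualAlg k C] Y) :=
    LinearMap.mk₂ k (fun g s => g ∘ₗ s) (fun _ _ _ => rfl) (fun _ _ _ => rfl)
      (fun g s t => LinearMap.ext fun x => map_add g (s x) (t x))
      (fun a g s => LinearMap.ext fun x => (g.restrictScalars k).map_smul a (s x))
  refine Module.Finite.of_injective Φ ((injective_iff_map_eq_zero Φ).2 fun g hg => ?_)
  by_contra hne
  have hsurj : LinearMap.range g = ⊤ := (hY _).resolve_left fun H =>
    hne (LinearMap.range_eq_bot.1 H)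
  -- the restriction of `g₀` lifts along `g`, by means of the dual basis
  choose y hy using fun i => LinearMap.range_eq_top.1 hsurj (g₀ (c i))
  let s : V →ₗ[DualAlg k C] (regularComod k C).carrier := ∑ i,
    (LinearMap.toSpanSingleton (DualAlg k C) _ (y i)) ∘ₗ formToDual (B i).2 ∘ₗ V.subtype
  have hs : g (s ⟨c₀, Submodule.mem_span_singleton_self c₀⟩) = g₀ c₀ := by
    conv_rhs => rw [hB c₀ (Submodule.mem_span_singleton_self c₀), map_sum]
    rw [LinearMap.sum_apply, map_sum]
    refine Finset.sum_congr rfl fun i _ => ?_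
    rw [map_smul, ← hy i, ← map_smul]
    rfl
  refine hc₀ (hs.symm.trans ?_)
  exact LinearMap.congr_fun (LinearMap.congr_fun hg s) _

theorem LeftTorsionless.finite_hom (h : LeftTorsionless k C) [Module.Finite k Y] :
    Module.Finite k ((regularComod k C).carrier →ₗ[DualAlg k C] Y) := by
  obtain ⟨n, hn⟩ : ∃ n, Module.finrank k Y < n := ⟨_, Nat.lt_succ_self _⟩
  induction n generalizing Y with
  | zero => omega
  | succ n ih =>
    by_cases hY : ∀ K : Submodule (DualAlg k C) Y, K = ⊥ ∨ K = ⊤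
    · exact h.finite_hom_of_simple hY
    push Not at hY
    obtain ⟨K, hbot, htop⟩ := hY
    have : Module.Finite k K :=
      Module.Finite.of_injective (K.subtype.restrictScalars k) Subtype.val_injective
    have hlt : Module.finrank k K < Module.finrank k Y :=
      Submodule.finrank_lt (s := K.restrictScalars k)
        (fun H => htop ((Submodule.restrictScalars_eq_top_iff k _ _).1 H))
    have hpos : 0 < Module.finrank k K := by
      have : Nontrivial K := Submodule.nontrivial_iff_ne_bot.2 hbot
      have : Module.Free k K := Module.Free.of_divisionRing k K
      exact Module.finrank_pos (R := k) (M := K)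
    have hsum := LinearMap.finrank_range_add_finrank_ker (K.mkQ.restrictScalars k)
    have h1 : LinearMap.range (K.mkQ.restrictScalars k) = ⊤ :=
      LinearMap.range_eq_top.2 K.mkQ_surjective
    have h2 : Module.finrank k (LinearMap.ker (K.mkQ.restrictScalars k)) = Module.finrank k K := by
      rw [LinearMap.ker_restrictScalars, Submodule.ker_mkQ]
      rfl
    rw [h1, finrank_top, h2] at hsum
    have f1 := ih (Y := K) (by omega)
    have f2 := ih (Y := Y ⧸ K) (by omega)
    exact finite_hom_of_exact (Y₁ := K) _ K.subtype K.mkQ Subtype.val_injective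
      (LinearMap.exact_subtype_mkQ K)

/-- If the right action of `f` on `C` factors through a finite-dimensional module `Y`, then the left
action of `f` has finite rank, because the space of homomorphisms `C → Y` is finite-dimensional. -/
theorem LeftTorsionless.finite_range_coalgActL_of_factor (h : LeftTorsionless k C)
    (f : DualAlg k C) [Module.Finite k Y] (p : (regularComod k C).carrier →ₗ[DualAlg k C] Y)
    (i : Y →ₗ[DualAlg k C] (regularComod k C).carrier) (hip : i ∘ₗ p = coalgActREnd f) :
    Module.Finite k (LinearMap.range (coalgActL k f)) := by
  have hfin := h.finite_hom (Y := Y)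
  -- `f ⇀ c` is determined by the values at `c` of the homomorphisms from `C` to `Y`
  let θ : C →ₗ[k] Module.Dual k ((regularComod k C).carrier →ₗ[DualAlg k C] Y) :=
    LinearMap.mk₂ k (fun c g => regularCounit k C (i (g c)))
      (fun c d g => by
        rw [← map_add, ← map_add]
        exact congrArg (fun y => regularCounit k C (i y)) (map_add g c d))
      (fun a c g => by
        rw [← map_smul]
        exact congrArg (regularCounit k C) (((i ∘ₗ g).restrictScalars k).map_smul a c))
      (fun c g g' => by rw [← map_add, ← map_add]; rfl)
      (fun a c g => by
        rw [← map_smul]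
        exact congrArg (regularCounit k C) ((i.restrictScalars k).map_smul a (g c)))
  have hker : LinearMap.ker θ ≤ LinearMap.ker (coalgActL k f) := by
    intro c hc
    refine eq_of_forall_dualAlg (k := k) fun a => ?_
    have h1 : regularCounit k C (i (p (coalgActREnd a c))) = 0 :=
      LinearMap.congr_fun hc (p ∘ₗ coalgActREnd a)
    have h2 : i (p (coalgActREnd a c)) = coalgActR k f (coalgActR k a c) :=
      LinearMap.congr_fun hip (coalgActREnd a c)
    rw [h2] at h1
    change Coalgebra.counit (R := k) (coalgActR k f (coalgActR k a c)) = 0 at h1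
    rw [counit_coalgActR, ← convMul_apply_right, convMul_apply_left] at h1
    rw [h1, map_zero]
  have hq : Module.Finite k (C ⧸ LinearMap.ker θ) :=
    Module.Finite.equiv θ.quotKerEquivRange.symm
  rw [← Submodule.range_liftQ (LinearMap.ker θ) (coalgActL k f) hker]
  infer_instance

end HomFinite

/-- If `C` is a torsionless left `C^*`-module, then a functional whose right action on `C` has
finite rank also acts with finite rank from the left. -/
theorem LeftTorsionless.finite_range_coalgActL (h : LeftTorsionless k C) (f : DualAlg k C)
    (hf : Module.Finite k (LinearMap.range (coalgActR k f))) :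
    Module.Finite k (LinearMap.range (coalgActL k f)) := by
  have hY : Module.Finite k (LinearMap.range (coalgActREnd f)) := hf
  exact h.finite_range_coalgActL_of_factor (Y := LinearMap.range (coalgActREnd f)) f
    (coalgActREnd f).rangeRestrict (LinearMap.range (coalgActREnd f)).subtype
    (LinearMap.ext fun _ => rfl)

/-- If the right exact Nakayama functor preserves monomorphisms, then a functional whose left
action on `C` has finite rank kills the elements `c` with `c ⊗ d = 0` in `C ⊗_{C^*} C` for all
`d`. -/
theorem apply_eq_zero_of_balancedTmul_eq_zero [(nakR k C).PreservesMonomorphisms]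
    (f : DualAlg k C) [Module.Finite k (LinearMap.range (coalgActL k f))] {c : C}
    (hc : ∀ d, balancedTmul (regularComod k C) d c = 0) : f.ofConv c = 0 := by
  -- With a basis `b` of the range, `f ⇀ c = ∑ j, ξ j c • b j`.
  let b := Module.finBasis k (LinearMap.range (coalgActL k f))
  set n := Module.finrank k (LinearMap.range (coalgActL k f))
  let y : Fin n → (regularComod k C).carrier := fun j => (b j : C)
  let ξ : Fin n → C → k := fun j c => b.repr ⟨coalgActL k f c, c, rfl⟩ j
  have hy : ∀ c, coalgActL k f c = ∑ j, ξ j c • (b j : C) := fun c => by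
    have := congrArg Subtype.val (b.sum_repr ⟨coalgActL k f c, c, rfl⟩)
    rw [Submodule.coe_sum] at this
    exact this.symm
  -- The left module `C^* f` is realised as the submodule of `C^n` generated by `y`.
  let M := ratComod k C (Fin n → (regularComod k C).carrier)
  let ι : Fin n → (regularComod k C ⟶ M) := fun j =>
    toRatComod (LinearMap.single (DualAlg k C) (fun _ : Fin n => (regularComod k C).carrier) j)
  let y' : M.carrier := ∑ j, Comod.lin (ι j) (y j)
  have hy' : ∀ j, ratInclusion k C (Fin n → (regularComod k C).carrier) y' j = y j := fun j => by
    rw [map_sum, Finset.sum_apply]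
    refine (Finset.sum_eq_single j (fun i _ hij => ?_) (by simp)).trans ?_
    · exact Pi.single_eq_of_ne hij.symm _
    · exact Pi.single_eq_same j _
  let K : Submodule (DualAlg k C) M.carrier := Submodule.span _ {y'}
  let y₀ : (Comod.sub K).carrier := Comod.subMk K ⟨y', Submodule.mem_span_singleton_self y'⟩
  let coord : Fin n → (Comod.sub K).carrier →ₗ[DualAlg k C] (regularComod k C).carrier := fun j =>
    LinearMap.proj j ∘ₗ ratInclusion k C (Fin n → (regularComod k C).carrier) ∘ₗ
      Comod.dualLin (Comod.subι K)
  -- The form `(c, a y) ↦ (a * f) c`, written in coordinates to show that it does not depend on the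
  -- choice of `a`; it is balanced and so gives a linear form on `C ⊗_{C^*} C^* y`.
  let S : (Comod.sub K).carrier → C → k := fun x c => ∑ j, ξ j c * regularCounit k C (coord j x)
  have hS : ∀ (a : DualAlg k C) (x : (Comod.sub K).carrier) (c : C),
      Comod.lin (Comod.subι K) x = a • y' → S x c = (a * f).ofConv c := by
    intro a x c hx
    rw [convMul_apply_left, hy, map_sum]
    refine Finset.sum_congr rfl fun j _ => ?_
    rw [map_smul, smul_eq_mul]
    congr 1
    have h1 : coord j x = a • y j := by
      refine (congrArg (fun z => ratInclusion k C (Fin n → (regularComod k C).carrier) z j)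
        hx).trans ?_
      rw [map_smul, Pi.smul_apply, hy']
    rw [h1, regularCounit_smul]
  have hgen : ∀ x : (Comod.sub K).carrier, ∃ a : DualAlg k C,
      Comod.lin (Comod.subι K) x = a • y' := fun x => by
    obtain ⟨a, ha⟩ := Submodule.mem_span_singleton.1 (Comod.subι_mem K x)
    exact ⟨a, ha.symm⟩
  let l : BalancedTensor (Comod.sub K) →ₗ[k] k := balancedLift
    (LinearMap.mk₂ k (fun c x => S x c)
      (fun c d x => by
        obtain ⟨a, ha⟩ := hgen x
        rw [hS a x _ ha, hS a x _ ha, hS a x _ ha, map_add])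
      (fun r c x => by
        obtain ⟨a, ha⟩ := hgen x
        rw [hS a x _ ha, hS a x _ ha, map_smul])
      (fun c x x' => by
        obtain ⟨a, ha⟩ := hgen x
        obtain ⟨a', ha'⟩ := hgen x'
        rw [hS a x _ ha, hS a' x' _ ha', hS (a + a') (x + x') _ (by rw [map_add, ha, ha', add_smul]),
          add_mul]
        rfl)
      (fun r c x => by
        obtain ⟨a, ha⟩ := hgen x
        rw [hS a x _ ha, hS (r • a) (r • x) _ (by rw [map_smul, ha, smul_assoc]), smul_mul_assoc]
        rfl))
    (fun g c x => by
      obtain ⟨a, ha⟩ := hgen x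
      rw [LinearMap.mk₂_apply, LinearMap.mk₂_apply, hS a x _ ha,
        hS (g * a) (g • x) _ (by rw [Comod.lin_smul, ha, mul_smul]), mul_assoc,
        convMul_apply_right g])
  have hzero : balancedTmul M y' c = 0 := by
    have h1 : ∀ j, balancedTmul M (Comod.lin (ι j) (y j)) c = 0 := fun j => by
      rw [← nakR_map_tmul (ι j), hc]
      exact map_zero _
    have h2 : balancedTmul M y' c = ∑ j, balancedTmul M (Comod.lin (ι j) (y j)) c := by
      simp only [balancedTmul, LinearMap.comp_apply, y', map_sum, LinearMap.sum_apply]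
    rw [h2]
    exact Finset.sum_eq_zero fun j _ => h1 j
  -- `c ⊗ y` vanishes in `C ⊗_{C^*} C^n`, hence already in `C ⊗_{C^*} C^* y`.
  have : Mono (Comod.subι K) := Comod.mono_of_injective _ (Comod.subι_injective K)
  have : Mono ((nakR k C).map (Comod.subι K)) := inferInstance
  have hzero' : balancedTmul (Comod.sub K) y₀ c = 0 :=
    Comod.injective_of_mono ((nakR k C).map (Comod.subι K))
      (((nakR_map_tmul (Comod.subι K) y₀ c).trans hzero).trans (map_zero _).symm)
  have h3 : l (balancedTmul (Comod.sub K) y₀ c) = f.ofConv c := by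
    refine (hS 1 y₀ c (one_smul _ _).symm).trans ?_
    rw [one_mul]
  rw [← h3, hzero', map_zero]

/-- An element `c` killed by all balanced forms satisfies `(c ↼ f) ⊗ d = 0` for all `f` and `d`, and
some functional of finite rank agrees with the counit at `c ↼ f`. -/
theorem rightTorsionless_of_preservesMonomorphisms [(nakR k C).PreservesMonomorphisms]
    (h : LeftTorsionless k C) : RightTorsionless k C := by
  intro c hc
  refine eq_of_forall_dualAlg (k := k) fun f => ?_
  rw [map_zero, ← counit_coalgActR]
  set c' := coalgActR k f c
  have hc' : ∀ d, balancedTmul (regularComod k C) d c' = 0 := fun d => by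
    rw [← balancedTmul_smul_dual]
    exact balancedTmul_eq_zero_of_forms (c := c) fun B hB => hc B hB _
  obtain ⟨g, hg, hfin⟩ := h.exists_finite_range (k ∙ c')
  have := h.finite_range_coalgActL g hfin
  rw [← hg c' (Submodule.mem_span_singleton_self c')]
  exact apply_eq_zero_of_balancedTmul_eq_zero g hc'

end ExactFaithful

/-! ### Decomposition of locally finite quasi-injective modules -/

section Decomposition

variable {k R X Q : Type*} [Field k] [Ring R] [SMul k R] [AddCommGroup X] [Module k X] [Module R X]
  [IsScalarTower k R X] [AddCommGroup Q] [Module R Q]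

/-- Some linear projection of the module onto the submodule `E` exists. -/
def IsRetractSubmodule (E : Submodule R X) : Prop :=
  ∃ r : X →ₗ[R] X, (∀ x, r x ∈ E) ∧ ∀ x ∈ E, r x = x

variable (R X) in
/-- Any two disjoint submodules are separated by an endomorphism that is the identity on the first
and zero on the second. -/
def SeparatesDisjoint : Prop :=
  ∀ N K : Submodule R X, Disjoint N K →
    ∃ g : X →ₗ[R] X, (∀ x ∈ N, g x = x) ∧ ∀ x ∈ K, g x = 0

variable (k R X) in
/-- The identity of every finite-dimensional submodule extends to an endomorphism of finite rank. -/
def HasFiniteRankUnits : Prop :=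
  ∀ N : Submodule R X, Module.Finite k (N.restrictScalars k) → ∃ g : X →ₗ[R] X,
    (∀ x ∈ N, g x = x) ∧ Module.Finite k (LinearMap.range (g.restrictScalars k))

/-- `E` is an essential extension of its submodule `N`. -/
def IsEssentialIn (N E : Submodule R X) : Prop :=
  N ≤ E ∧ ∀ K ≤ E, Disjoint N K → K = ⊥

theorem SeparatesDisjoint.isRetractSubmodule_sup (h : SeparatesDisjoint R X)
    {E F : Submodule R X} (hE : IsRetractSubmodule E) (hF : IsRetractSubmodule F)
    (hEF : Disjoint E F) : IsRetractSubmodule (E ⊔ F) := by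
  obtain ⟨r, hr, hr'⟩ := hE
  obtain ⟨s, hs, hs'⟩ := hF
  obtain ⟨g, hgE, hgF⟩ := h E F hEF
  obtain ⟨g', hgF', hgE'⟩ := h F E hEF.symm
  refine ⟨r ∘ₗ g + s ∘ₗ g', fun x => Submodule.add_mem_sup (hr _) (hs _), fun x hx => ?_⟩
  obtain ⟨y, hy, z, hz, rfl⟩ := Submodule.mem_sup.1 hx
  simp [hgE y hy, hgF z hz, hgF' z hz, hgE' y hy, hr' y hy, hs' z hz]

theorem SeparatesDisjoint.isRetractSubmodule_finset_sup (h : SeparatesDisjoint R X)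
    {S : Set (Submodule R X)} (hS : sSupIndep S) (hret : ∀ E ∈ S, IsRetractSubmodule E)
    (t : Finset (Submodule R X)) (ht : (t : Set (Submodule R X)) ⊆ S) :
    IsRetractSubmodule (t.sup id) := by
  classical
  induction t using Finset.induction_on with
  | empty => exact ⟨0, fun x => by simp, fun x hx => by simpa using hx.symm⟩
  | insert E t hE ih =>
    rw [Finset.coe_insert, Set.insert_subset_iff] at ht
    rw [Finset.sup_insert, id]
    refine h.isRetractSubmodule_sup (hret E ht.1) (ih ht.2) ?_
    rw [Finset.sup_id_eq_sSup]
    exact hS.disjoint_sSup ht.1 ht.2 hE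

theorem finite_restrictScalars_sup {E F : Submodule R X}
    (hE : Module.Finite k (E.restrictScalars k)) (hF : Module.Finite k (F.restrictScalars k)) :
    Module.Finite k ((E ⊔ F).restrictScalars k) := by
  refine Submodule.finiteDimensional_of_le (S₂ := E.restrictScalars k ⊔ F.restrictScalars k) ?_
  intro y hy
  obtain ⟨a, ha, b, hb, rfl⟩ := Submodule.mem_sup.1 hy
  exact Submodule.add_mem_sup (S := E.restrictScalars k) (T := F.restrictScalars k) ha hb

theorem finite_restrictScalars_of_le {E F : Submodule R X} (h : E ≤ F)
    (hF : Module.Finite k (F.restrictScalars k)) : Module.Finite k (E.restrictScalars k) :=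
  Submodule.finiteDimensional_of_le (S₂ := F.restrictScalars k) h

/-- Every finite-dimensional submodule has a finite-dimensional injective hull: a direct summand in
which it is essential, the range of an endomorphism of minimal rank that is the identity on it. -/
theorem SeparatesDisjoint.exists_essential_retract (h : SeparatesDisjoint R X)
    (hfin : HasFiniteRankUnits k R X) (N : Submodule R X)
    (hN : Module.Finite k (N.restrictScalars k)) :
    ∃ E : Submodule R X, Module.Finite k (E.restrictScalars k) ∧ IsRetractSubmodule E ∧
      IsEssentialIn N E := by
  let P : (X →ₗ[R] X) → Prop := fun g =>
    (∀ x ∈ N, g x = x) ∧ Module.Finite k (LinearMap.range (g.restrictScalars k))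
  obtain ⟨g, ⟨hgN, hgfin⟩, hmin⟩ := exists_minimalFor_of_wellFoundedLT P
    (fun g => Module.finrank k (LinearMap.range (g.restrictScalars k))) (hfin N hN)
  set E := LinearMap.range (g.restrictScalars k) with hE
  -- By minimality, an endomorphism `g ∘ a` that is the identity on `N` is injective on `E`.
  have key : ∀ a : X →ₗ[R] X, (∀ x ∈ N, a x = x) → ∀ x ∈ E, g (a x) = 0 → x = 0 := by
    intro a ha
    have hle : LinearMap.range ((g ∘ₗ a ∘ₗ g).restrictScalars k) ≤ E := by
      rintro _ ⟨x, rfl⟩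
      exact ⟨a (g x), rfl⟩
    have hP : P (g ∘ₗ a ∘ₗ g) := ⟨fun x hx => by
      simp only [LinearMap.comp_apply, hgN x hx, ha x hx], Submodule.finiteDimensional_of_le hle⟩
    have hrank := hmin hP (Submodule.finrank_mono hle)
    have heq := Submodule.eq_of_le_of_finrank_le hle hrank
    let T : E →ₗ[k] E := ((g ∘ₗ a).restrictScalars k).restrict fun x _ => ⟨a x, rfl⟩
    have hT : Function.Surjective T := by
      rintro ⟨y, hy⟩
      obtain ⟨x, hx⟩ := heq.symm ▸ hy
      exact ⟨⟨g x, x, rfl⟩, Subtype.ext hx⟩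
    intro x hx hx0
    have := (LinearMap.injective_iff_surjective.2 hT) (a₁ := ⟨x, hx⟩) (a₂ := 0)
      (by rw [map_zero]; exact Subtype.ext hx0)
    exact congrArg Subtype.val this
  have hinj : ∀ x ∈ E, g x = 0 → x = 0 := key LinearMap.id fun _ _ => rfl
  let T : LinearMap.range g →ₗ[R] LinearMap.range g := g.restrict fun x _ => ⟨x, rfl⟩
  have hTinj : Function.Injective T := (injective_iff_map_eq_zero T).2 fun x hx =>
    Subtype.ext (hinj x x.2 (congrArg Subtype.val hx))
  have hTbij : Function.Bijective T := by
    refine ⟨hTinj, ?_⟩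
    let T' : E →ₗ[k] E := (g.restrictScalars k).restrict fun x _ => ⟨x, rfl⟩
    have hT' : Function.Injective T' := fun x y hxy => hTinj hxy
    exact LinearMap.injective_iff_surjective.1 hT'
  let e := LinearEquiv.ofBijective T hTbij
  refine ⟨LinearMap.range g, hgfin,
    ⟨(LinearMap.range g).subtype ∘ₗ e.symm.toLinearMap ∘ₗ g.rangeRestrict, fun x => Subtype.prop _,
      fun x hx => ?_⟩, fun x hx => ⟨x, hgN x hx⟩, fun K hK hdisj => ?_⟩
  · exact congrArg Subtype.val (e.symm_apply_apply ⟨x, hx⟩)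
  · obtain ⟨a, haN, haK⟩ := h N K hdisj
    rw [Submodule.eq_bot_iff]
    intro x hx
    exact key a haN x (hK hx) (by rw [haK x hx, map_zero])

/-- A nonzero finite-dimensional submodule contains a simple one. -/
theorem exists_isAtom_le_of_finite (N : Submodule R X) (hN : Module.Finite k (N.restrictScalars k))
    (hne : N ≠ ⊥) : ∃ S ≤ N, IsAtom S := by
  obtain ⟨S, ⟨hSN, hS⟩, hmin⟩ := exists_minimalFor_of_wellFoundedLT
    (fun S : Submodule R X => S ≤ N ∧ S ≠ ⊥)
    (fun S => Module.finrank k (S.restrictScalars k)) ⟨N, le_rfl, hne⟩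
  refine ⟨S, hSN, hS, fun K hK => ?_⟩
  by_contra hne
  have hS : Module.Finite k (S.restrictScalars k) := finite_restrictScalars_of_le hSN hN
  have hlt : Module.finrank k (K.restrictScalars k) < Module.finrank k (S.restrictScalars k) :=
    Submodule.finrank_lt_finrank_of_lt (s := K.restrictScalars k) (t := S.restrictScalars k) hK
  exact absurd (hmin ⟨hK.le.trans hSN, hne⟩ hlt.le) (not_le.2 hlt)

theorem sSupIndep_insert {α : Type*} [CompleteLattice α] [IsModularLattice α] {s : Set α} {a : α}
    (hs : sSupIndep s) (ha : Disjoint a (sSup s)) : sSupIndep (insert a s) := by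
  intro x hx
  by_cases hxa : x = a
  · subst hxa
    exact ha.mono_right (sSup_le_sSup fun y hy => hy.1.resolve_left hy.2)
  · have hxs : x ∈ s := hx.resolve_left hxa
    have h1 : Disjoint x (sSup (s \ {x}) ⊔ a) :=
      (hs hxs).disjoint_sup_right_of_disjoint_sup_left
        (ha.symm.mono_left (sup_le (le_sSup hxs) (sSup_le_sSup Set.sdiff_subset)))
    refine h1.mono_right (sSup_le fun y hy => ?_)
    rcases hy.1 with rfl | hys
    · exact le_sup_right
    · exact le_sup_of_le_left (le_sSup ⟨hys, hy.2⟩)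

variable (k) in
/-- A finite-dimensional direct summand with an essential simple submodule. -/
def IsUniformSummand (E : Submodule R X) : Prop :=
  Module.Finite k (E.restrictScalars k) ∧ IsRetractSubmodule E ∧
    ∃ S : Submodule R X, IsAtom S ∧ IsEssentialIn S E

/-- A locally finite-dimensional module satisfying the two extension properties is the internal
direct sum of finite-dimensional submodules with essential simple submodules. -/
theorem SeparatesDisjoint.exists_decomposition (h : SeparatesDisjoint R X)
    (hfin : HasFiniteRankUnits k R X)
    (hloc : ∀ x : X, Module.Finite k ((Submodule.span R {x}).restrictScalars k)) :
    ∃ S : Set (Submodule R X), sSupIndep S ∧ sSup S = ⊤ ∧ ∀ E ∈ S, IsUniformSummand k E := by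
  obtain ⟨S, hmax⟩ := zorn_subset {S : Set (Submodule R X) | sSupIndep S ∧
      ∀ E ∈ S, IsUniformSummand k E} fun c hc hchain => ⟨⋃₀ c,
    ⟨iSupIndep_sUnion_of_directed hchain.directedOn fun s hs => (hc hs).1,
      fun E ⟨s, hs, hE⟩ => (hc hs).2 E hE⟩, fun _ => Set.subset_sUnion_of_mem⟩
  obtain ⟨hind, hgood⟩ := hmax.prop
  refine ⟨S, hind, ?_, hgood⟩
  by_contra hne
  obtain ⟨x, hx⟩ : ∃ x, x ∉ sSup S := by
    by_contra! H
    exact hne (eq_top_iff.2 fun x _ => H x)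
  set D := sSup S with hD
  set V := Submodule.span R {x} with hV
  have hVfin := hloc x
  -- `V ⊓ D` is contained in a finite partial sum `E`, which is a direct summand.
  obtain ⟨t, htS, htle⟩ : ∃ t : Finset (Submodule R X), (t : Set (Submodule R X)) ⊆ S ∧
      V ⊓ D ≤ t.sup id := by
    have hfg : (V ⊓ D).FG := by
      have h1 : Module.Finite k ((V ⊓ D).restrictScalars k) :=
        finite_restrictScalars_of_le inf_le_left hVfin
      exact Submodule.FG.of_restrictScalars k (Module.Finite.iff_fg.1 h1)
    exact (CompleteLattice.isCompactElement_iff_exists_le_sSup_of_le_sSup _ _).1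
      ((Submodule.fg_iff_compact _).1 hfg) S inf_le_right
  set E := t.sup id with hE
  have hED : E ≤ D := Finset.sup_le fun F hF => le_sSup (htS hF)
  have hEfin : Module.Finite k (E.restrictScalars k) := by
    refine Finset.sup_induction (p := fun F : Submodule R X =>
      Module.Finite k (F.restrictScalars k)) ?_ (fun F hF G hG => finite_restrictScalars_sup hF hG)
      fun F hF => (hgood F (htS hF)).1
    rw [Submodule.restrictScalars_bot]
    infer_instance
  obtain ⟨r, hr, hr'⟩ := h.isRetractSubmodule_finset_sup hind (fun F hF => (hgood F hF).2.1) t htS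
  -- The complement `N` of `E` in `V ⊔ E` meets `D` trivially.
  set N := (V ⊔ E) ⊓ LinearMap.ker r with hN
  have hNfin : Module.Finite k (N.restrictScalars k) :=
    finite_restrictScalars_of_le inf_le_left (finite_restrictScalars_sup hVfin hEfin)
  have hND : Disjoint N D := by
    rw [Submodule.disjoint_def]
    intro y hy hyD
    have hyE : y ∈ E := by
      obtain ⟨a, ha, b, hb, rfl⟩ := Submodule.mem_sup.1 hy.1
      have haD : a ∈ D := by simpa using D.sub_mem hyD (hED hb)
      exact E.add_mem (htle ⟨ha, haD⟩) hb
    rw [← hr' y hyE]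
    exact hy.2
  have hNne : N ≠ ⊥ := by
    intro hbot
    have hxV : x ∈ V := Submodule.mem_span_singleton_self x
    have h1 : x - r x ∈ N := ⟨Submodule.sub_mem _ (Submodule.mem_sup_left hxV)
      (Submodule.mem_sup_right (hr x)), by simp [hr' (r x) (hr x)]⟩
    rw [hbot, Submodule.mem_bot, sub_eq_zero] at h1
    exact hx (hED (h1 ▸ hr x))
  obtain ⟨A, hAN, hA⟩ := exists_isAtom_le_of_finite N hNfin hNne
  obtain ⟨F, hFfin, hFret, hAF⟩ := h.exists_essential_retract hfin A
    (finite_restrictScalars_of_le hAN hNfin)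
  have hFD : Disjoint F D := by
    rw [disjoint_iff]
    refine hAF.2 _ inf_le_left ?_
    exact (hND.mono_left hAN).mono_right inf_le_right
  have hF : F ∈ S := hmax.le_of_ge (y := insert F S) ⟨sSupIndep_insert hind hFD, fun G hG => by
    rcases hG with rfl | hG
    · exact ⟨hFfin, hFret, A, hA, hAF⟩
    · exact hgood G hG⟩ (Set.subset_insert F S) (Set.mem_insert F S)
  have hFbot : F = ⊥ := by
    have := hFD.mono_right (le_sSup hF)
    rwa [disjoint_self] at this
  exact hA.1 (le_bot_iff.1 (hFbot ▸ hAF.1))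

/-- A module as in `SeparatesDisjoint.exists_decomposition` that is cogenerated by `Q` embeds into
a direct sum of copies of `Q`: a homomorphism to `Q` which does not kill the essential simple
submodule of a summand is injective on this summand. -/
theorem SeparatesDisjoint.exists_embedding (h : SeparatesDisjoint R X)
    (hfin : HasFiniteRankUnits k R X)
    (hloc : ∀ x : X, Module.Finite k ((Submodule.span R {x}).restrictScalars k))
    (hQ : ∀ x : X, x ≠ 0 → ∃ p : X →ₗ[R] Q, p x ≠ 0) :
    ∃ (S : Set (Submodule R X)) (φ : X →ₗ[R] (S →₀ Q)), Function.Injective φ := by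
  classical
  obtain ⟨S, hind, htop, hgood⟩ := h.exists_decomposition hfin hloc
  have hp : ∀ E : S, ∃ p : X →ₗ[R] Q, Function.Injective (p ∘ₗ E.1.subtype) := by
    rintro ⟨E, hE⟩
    obtain ⟨-, -, A, hA, hAE⟩ := hgood E hE
    obtain ⟨x, hxA, hx⟩ := Submodule.exists_mem_ne_zero_of_ne_bot hA.1
    obtain ⟨p, hp⟩ := hQ x hx
    refine ⟨p, (injective_iff_map_eq_zero _).2 fun y hy => ?_⟩
    have hdisj : Disjoint A (E ⊓ LinearMap.ker p) := by
      refine (IsAtom.not_le_iff_disjoint hA).1 fun hle => hp (hle hxA).2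
    have h1 := hAE.2 _ inf_le_left hdisj
    exact Subtype.ext ((Submodule.mem_bot R).1 (h1 ▸ ⟨y.2, hy⟩))
  choose p hp using hp
  have hint : DirectSum.IsInternal (fun E : S => E.1) :=
    DirectSum.isInternal_submodule_of_iSupIndep_of_iSup_eq_top ((sSupIndep_iff S).1 hind)
      (by rw [← sSup_eq_iSup', htop])
  let e := LinearEquiv.ofBijective (DirectSum.coeLinearMap fun E : S => E.1) hint
  refine ⟨S, (finsuppLequivDFinsupp R).symm.toLinearMap ∘ₗ
    DFinsupp.mapRange.linearMap (fun E : S => p E ∘ₗ E.1.subtype) ∘ₗ e.symm.toLinearMap, ?_⟩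
  have hmap : Function.Injective
      (DFinsupp.mapRange.linearMap (fun E : S => p E ∘ₗ E.1.subtype)) :=
    (DFinsupp.mapRange_injective _ fun _ => map_zero _).2 hp
  exact (finsuppLequivDFinsupp R).symm.injective.comp (hmap.comp e.symm.injective)

end Decomposition

/-! ### Torsionless coalgebras are quasi-co-Frobenius -/

section TorsionlessQcF

variable {k : Type u} {C : Type v} [Field k] [AddCommGroup C] [Module k C] [Coalgebra k C]

/-- A functional on the sum of two disjoint subspaces, given by `e` and `0`, extends to the whole
space. -/
theorem exists_functional_of_disjoint {V : Type*} [AddCommGroup V] [Module k V]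
    {N K : Submodule k V} (h : Disjoint N K) (e : Module.Dual k V) :
    ∃ f : Module.Dual k V, (∀ x ∈ N, f x = e x) ∧ ∀ x ∈ K, f x = 0 := by
  obtain ⟨l, hl⟩ := LinearMap.exists_leftInverse_of_injective (K.mkQ ∘ₗ N.subtype) (by
    rw [LinearMap.ker_comp, Submodule.ker_mkQ]
    exact Submodule.disjoint_iff_comap_eq_bot.1 h)
  refine ⟨e ∘ₗ N.subtype ∘ₗ l ∘ₗ K.mkQ, fun x hx => ?_, fun x hx => ?_⟩
  · exact congrArg (fun y : N => e y) (LinearMap.congr_fun hl ⟨x, hx⟩)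
  · have : K.mkQ x = 0 := (Submodule.Quotient.mk_eq_zero K).2 hx
    simp [LinearMap.comp_apply, this]

theorem coalgActR_eq_self {f : DualAlg k C} {c : C}
    (h : ∀ g : DualAlg k C, f.ofConv (coalgActL k g c) = Coalgebra.counit (coalgActL k g c)) :
    coalgActR k f c = c :=
  eq_of_forall_dualAlg (k := k) fun g => by
    rw [← convMul_apply_right, convMul_apply_left, h, counit_coalgActL]

theorem coalgActR_eq_zero {f : DualAlg k C} {c : C}
    (h : ∀ g : DualAlg k C, f.ofConv (coalgActL k g c) = 0) : coalgActR k f c = 0 :=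
  eq_of_forall_dualAlg (k := k) fun g => by
    rw [← convMul_apply_right, convMul_apply_left, h, map_zero]

theorem coalgActL_eq_self {f : DualAlg k C} {c : C}
    (h : ∀ g : DualAlg k C, f.ofConv (coalgActR k g c) = Coalgebra.counit (coalgActR k g c)) :
    coalgActL k f c = c :=
  eq_of_forall_dualAlg (k := k) fun g => by
    rw [← convMul_apply_left, convMul_apply_right, h, counit_coalgActR]

theorem coalgActL_eq_zero {f : DualAlg k C} {c : C}
    (h : ∀ g : DualAlg k C, f.ofConv (coalgActR k g c) = 0) : coalgActL k f c = 0 :=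
  eq_of_forall_dualAlg (k := k) fun g => by
    rw [← convMul_apply_left, convMul_apply_right, h, map_zero]

variable (k C) in
/-- A functional that is the counit on one submodule and zero on another acts as the identity on
the first and as zero on the second. -/
theorem separatesDisjoint_left :
    SeparatesDisjoint (DualAlg k C) (regularComod k C).carrier := by
  intro N K h
  obtain ⟨f, hfN, hfK⟩ := exists_functional_of_disjoint (V := C) (N := N.restrictScalars k)
    (K := K.restrictScalars k) ((Submodule.disjoint_def (M := C)).2 fun x hx hx' =>
      Submodule.disjoint_def.1 h x hx hx') (Coalgebra.counit (R := k) (A := C))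
  refine ⟨coalgActREnd (WithConv.toConv f), fun x hx => ?_, fun x hx => ?_⟩
  · exact coalgActR_eq_self (C := C) fun g => hfN _ (N.smul_mem g hx)
  · exact coalgActR_eq_zero (C := C) fun g => hfK _ (K.smul_mem g hx)

theorem LeftTorsionless.hasFiniteRankUnits (h : LeftTorsionless k C) :
    HasFiniteRankUnits k (DualAlg k C) (regularComod k C).carrier := by
  intro N hN
  let N' : Submodule k C := N.restrictScalars k
  have hN' : Module.Finite k N' := hN
  obtain ⟨f, hf, hfin⟩ := h.exists_finite_range N'
  exact ⟨coalgActREnd f, fun x hx => coalgActR_eq_self (C := C) fun g => hf _ (N.smul_mem g hx),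
    hfin⟩

theorem LeftTorsionless.isLeftQcF (h : LeftTorsionless k C) : IsLeftQcF k C := by
  obtain ⟨S, φ, hφ⟩ := (separatesDisjoint_left k C).exists_embedding (Q := DualAlg k C)
    h.hasFiniteRankUnits (fun x => Comod.finite_span_singleton x) fun x hx => by
      by_contra! H
      refine hx (h x fun B hB c => ?_)
      exact congrArg (fun g : DualAlg k C => g.ofConv c) (H (formToDual hB))
  exact ⟨S, φ.restrictScalars k, hφ, φ.map_smul⟩

/-- The coalgebra `C` as a right `C^*`-module. The first argument, the ground field, allows the
module structure to be found by instance search. -/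
def RightRegular (_ : Type u) (C : Type v) : Type v := C

instance : AddCommGroup (RightRegular k C) := inferInstanceAs (AddCommGroup C)

instance : Module k (RightRegular k C) := inferInstanceAs (Module k C)

instance : Module (DualAlg k C)ᵐᵒᵖ (RightRegular k C) where
  smul f c := coalgActR (C := C) k f.unop c
  one_smul c := LinearMap.congr_fun (coalgActR_one (C := C)) c
  mul_smul f g c := LinearMap.congr_fun (coalgActR_mul (C := C) g.unop f.unop) c
  smul_zero f := (coalgActR (C := C) k f.unop).map_zero
  smul_add f := (coalgActR (C := C) k f.unop).map_add
  add_smul f g c := LinearMap.congr_fun (coalgActR_add (C := C) f.unop g.unop) c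
  zero_smul c := LinearMap.congr_fun (coalgActR_zero (C := C)) c

instance : IsScalarTower k (DualAlg k C)ᵐᵒᵖ (RightRegular k C) where
  smul_assoc a f c := LinearMap.congr_fun (coalgActR_smul (C := C) a f.unop) c

/-- The left action of a functional, as an endomorphism of the right `C^*`-module `C`. -/
def coalgActLEnd (f : DualAlg k C) :
    RightRegular k C →ₗ[(DualAlg k C)ᵐᵒᵖ] RightRegular k C where
  toFun := coalgActL (C := C) k f
  map_add' := (coalgActL (C := C) k f).map_add
  map_smul' g c := Comod.lin_smul (M := regularComod k C) (N := regularComod k C)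
    (Comod.ofLin (M := regularComod k C) (N := regularComod k C) (coalgActR (C := C) k g.unop)
      (comul_coalgActR g.unop)) f c |>.symm

variable (k C) in
theorem separatesDisjoint_right : SeparatesDisjoint (DualAlg k C)ᵐᵒᵖ (RightRegular k C) := by
  intro N K h
  obtain ⟨f, hfN, hfK⟩ := exists_functional_of_disjoint (V := C) (N := N.restrictScalars k)
    (K := K.restrictScalars k) ((Submodule.disjoint_def (M := C)).2 fun x hx hx' =>
      Submodule.disjoint_def.1 h x hx hx') (Coalgebra.counit (R := k) (A := C))
  refine ⟨coalgActLEnd (WithConv.toConv f), fun x hx => ?_, fun x hx => ?_⟩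
  · exact coalgActL_eq_self (C := C) fun g => hfN _ (N.smul_mem (MulOpposite.op g) hx)
  · exact coalgActL_eq_zero (C := C) fun g => hfK _ (K.smul_mem (MulOpposite.op g) hx)

theorem RightTorsionless.hasFiniteRankUnits (h : RightTorsionless k C) :
    HasFiniteRankUnits k (DualAlg k C)ᵐᵒᵖ (RightRegular k C) := by
  intro N hN
  let N' : Submodule k C := N.restrictScalars k
  have hN' : Module.Finite k N' := hN
  obtain ⟨n, B, d, hB⟩ := h.exists_counit_eq N'
  let f : DualAlg k C := ∑ i, WithConv.toConv ((B i).1.flip (d i))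
  refine ⟨coalgActLEnd f, fun x hx => coalgActL_eq_self (C := C) fun g => ?_, ?_⟩
  · refine Eq.trans ?_ (hB (coalgActR (C := C) k g x) (N.smul_mem (MulOpposite.op g) hx)).symm
    exact (congrArg (fun l : C →ₗ[k] k => l (coalgActR (C := C) k g x))
      (WithConv.ofConv_sum _ _)).trans (LinearMap.sum_apply _ _ _)
  · choose W hW hdW using fun i => exists_finite_forall_tensorEval_mem
      (TensorProduct.comm k C C (Coalgebra.comul (R := k) (d i)))
    let V : Submodule k C := ⨆ i, W i
    have hV : FiniteDimensional k V := Submodule.finiteDimensional_iSup W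
    suffices key : LinearMap.range (coalgActL (C := C) k f) ≤ V from
      @Submodule.finiteDimensional_of_le k C _ _ _ _ V hV key
    rintro _ ⟨c, rfl⟩
    have h1 : coalgActL k f c = ∑ i, coalgActL k (WithConv.toConv ((B i).1.flip (d i))) c :=
      Finset.sum_smul (R := DualAlg k C) (M := (regularComod k C).carrier)
    change coalgActL k f c ∈ _
    rw [h1]
    refine Submodule.sum_mem _ fun i _ => Submodule.mem_iSup_of_mem i ?_
    rw [← coalgActR_form (B i).2, coalgActR_eq_tensorEval]
    exact hdW i _

theorem finite_span_singleton_right (x : RightRegular k C) :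
    Module.Finite k ((Submodule.span (DualAlg k C)ᵐᵒᵖ {x}).restrictScalars k) := by
  obtain ⟨V, hfin, hV⟩ := exists_finite_forall_tensorEval_mem
    (TensorProduct.comm k C C (Coalgebra.comul (R := k) (A := C) x))
  let K₀ : Submodule (DualAlg k C)ᵐᵒᵖ (RightRegular k C) := Submodule.span _ {x}
  let K : Submodule k C := Submodule.restrictScalars (M := RightRegular k C) k K₀
  suffices key : K ≤ V from @Submodule.finiteDimensional_of_le k C _ _ _ K V hfin key
  intro y hy
  obtain ⟨f, rfl⟩ := (Submodule.mem_span_singleton (M := RightRegular k C)).1 hy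
  exact (congrArg (· ∈ V) (coalgActR_eq_tensorEval (C := C) f.unop x)).mpr (hV f.unop)

theorem RightTorsionless.isRightQcF (h : RightTorsionless k C) : IsRightQcF k C := by
  obtain ⟨S, φ, hφ⟩ := (separatesDisjoint_right k C).exists_embedding (Q := DualAlg k C)
    h.hasFiniteRankUnits finite_span_singleton_right fun x hx => by
      by_contra! H
      refine hx (h x fun B hB d => ?_)
      have := H
        { toFun := fun c : RightRegular k C => (WithConv.toConv (B c) : DualAlg k C)
          map_add' := fun c c' => congrArg WithConv.toConv (map_add B c c')
          map_smul' := fun f c => toConv_form_coalgActR hB f.unop c }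
      exact LinearMap.congr_fun (congrArg WithConv.ofConv this) d
  exact ⟨S, φ.restrictScalars k, hφ, fun f c => φ.map_smul (MulOpposite.op f) c⟩

/-! ### Equivalence of the characterisations -/

variable (k C)

theorem isQcF_iff_torsionless : IsQcF k C ↔ LeftTorsionless k C ∧ RightTorsionless k C :=
  ⟨fun h => ⟨h.1.leftTorsionless, h.2.rightTorsionless⟩, fun h => ⟨h.1.isLeftQcF, h.2.isRightQcF⟩⟩

theorem isQcF_tfae : [IsQcF k C,
    (nakL k C).IsEquivalence,
    (nakR k C).IsEquivalence,
    Limits.PreservesFiniteLimits (nakR k C) ∧ Limits.PreservesFiniteColimits (nakR k C) ∧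
      (nakR k C).Faithful].TFAE := by
  tfae_have 1 → 3 := fun h =>
    nakR_isEquivalence ((isQcF_iff_torsionless k C).1 h).1 ((isQcF_iff_torsionless k C).1 h).2
  tfae_have 2 → 3 := fun h => (nakAdjunction k C).isEquivalence_left_of_isEquivalence_right
  tfae_have 3 → 2 := fun h => (nakAdjunction k C).isEquivalence_right_of_isEquivalence_left
  tfae_have 3 → 4 := fun h => ⟨inferInstance, inferInstance, inferInstance⟩
  tfae_have 4 → 1 := by
    rintro ⟨h1, -, h2⟩
    have hl : LeftTorsionless k C := leftTorsionless_of_faithful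
    exact (isQcF_iff_torsionless k C).2 ⟨hl, rightTorsionless_of_preservesMonomorphisms hl⟩
  tfae_finish

end TorsionlessQcF

/-! ### Injective hulls and projective covers -/

section HullsAndCovers

variable {k : Type u} {C : Type v} [Field k] [AddCommGroup C] [Module k C] [Coalgebra k C]

theorem IsProjectiveCover.nonempty_iso {S P Q : Comod k C} {p : P ⟶ S} {q : Q ⟶ S}
    (hp : IsProjectiveCover p) (hq : IsProjectiveCover q) : Nonempty (P ≅ Q) := by
  have := hp.projective
  have := hq.projective
  have := hp.epi
  have := hq.epi
  let f : P ⟶ Q := Projective.factorThru p q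
  have hf : f ≫ q = p := Projective.factorThru_comp p q
  have : Epi f := hq.superfluous f (hf ▸ hp.epi)
  -- a section of `f` is again compatible with the maps to `S`, hence epi
  let s : Q ⟶ P := Projective.factorThru (𝟙 Q) f
  have hs : s ≫ f = 𝟙 Q := Projective.factorThru_comp (𝟙 Q) f
  have hsp : s ≫ p = q := by rw [← hf, ← Category.assoc, hs, Category.id_comp]
  have : Epi s := hp.superfluous s (hsp ▸ hq.epi)
  exact ⟨⟨f, s, by rw [← cancel_epi s, ← Category.assoc, hs, Category.id_comp, Category.comp_id],
    hs⟩⟩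

theorem IsInjectiveHull.nonempty_iso {S E F : Comod k C} {i : S ⟶ E} {j : S ⟶ F}
    (hi : IsInjectiveHull i) (hj : IsInjectiveHull j) : Nonempty (E ≅ F) := by
  have := hi.injective
  have := hj.injective
  have := hi.mono
  have := hj.mono
  let f : E ⟶ F := Injective.factorThru j i
  have hf : i ≫ f = j := Injective.comp_factorThru j i
  have : Mono f := hi.essential f (hf ▸ hj.mono)
  -- a retraction of `f` is again compatible with the maps from `S`, hence mono
  let r : F ⟶ E := Injective.factorThru (𝟙 E) f
  have hr : f ≫ r = 𝟙 E := Injective.comp_factorThru (𝟙 E) f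
  have hjr : j ≫ r = i := by rw [← hf, Category.assoc, hr, Category.comp_id]
  have : Mono r := hj.essential r (hjr ▸ hi.mono)
  exact ⟨⟨f, r, hr, by rw [← cancel_mono r, Category.assoc, hr, Category.id_comp,
    Category.comp_id]⟩⟩

theorem IsInjectiveHull.map {S E : Comod k C} {i : S ⟶ E} (hi : IsInjectiveHull i)
    (G : Comod k C ⥤ Comod k C) [G.IsEquivalence] : IsInjectiveHull (G.map i) where
  injective := (G.asEquivalence.map_injective_iff E).2 hi.injective
  mono := have := hi.mono; inferInstance
  essential X g hg := by
    let e := G.objObjPreimageIso X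
    obtain ⟨g', hg'⟩ := G.map_surjective (g ≫ e.inv)
    have h1 : Mono (G.map (i ≫ g')) := by
      rw [G.map_comp, hg', ← Category.assoc]
      infer_instance
    have := hi.essential g' (G.mono_of_mono_map h1)
    have h2 : Mono (g ≫ e.inv) := hg' ▸ inferInstance
    exact mono_of_mono g e.inv

theorem IsProjectiveCover.map {S P : Comod k C} {p : P ⟶ S} (hp : IsProjectiveCover p)
    (G : Comod k C ⥤ Comod k C) [G.IsEquivalence] : IsProjectiveCover (G.map p) where
  projective := (G.asEquivalence.map_projective_iff P).2 hp.projective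
  epi := have := hp.epi; inferInstance
  superfluous X g hg := by
    let e := G.objObjPreimageIso X
    obtain ⟨g', hg'⟩ := G.map_surjective (e.hom ≫ g)
    have h1 : Epi (G.map (g' ≫ p)) := by
      rw [G.map_comp, hg', Category.assoc]
      infer_instance
    have := hp.superfluous g' (G.epi_of_epi_map h1)
    have h2 : Epi (e.hom ≫ g) := hg' ▸ inferInstance
    exact epi_of_epi e.hom g

theorem IsProjectiveCover.comp_iso {S T P : Comod k C} {p : P ⟶ S} (hp : IsProjectiveCover p)
    (e : S ≅ T) : IsProjectiveCover (p ≫ e.hom) where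
  projective := hp.projective
  epi := have := hp.epi; inferInstance
  superfluous X g hg := hp.superfluous g (by
    have : Epi ((g ≫ p ≫ e.hom) ≫ e.inv) := inferInstance
    simpa using this)

namespace Comod

variable {S M N : Comod k C}

theorem mono_of_ne_zero [Simple S] {f : S ⟶ M} (hf : f ≠ 0) : Mono f := by
  let K := LinearMap.ker (dualLin f)
  have hK : subι K ≫ f = 0 := by ext x; exact subι_mem K x
  have := mono_of_injective _ (subι_injective K)
  refine mono_of_injective f ((injective_iff_map_eq_zero (lin f)).2 fun m hm => ?_)
  have h0 : subι K = 0 := by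
    by_contra h
    have := (Simple.mono_isIso_iff_nonzero (subι K)).2 h
    exact hf ((cancel_epi (subι K)).1 (hK.trans Limits.comp_zero.symm))
  exact LinearMap.congr_fun (congrArg lin h0) (subMk K ⟨m, hm⟩)

theorem epi_of_ne_zero [Simple S] {f : M ⟶ S} (hf : f ≠ 0) : Epi f := by
  let K := LinearMap.range (dualLin f)
  have hK : subLift K f (fun m => ⟨m, rfl⟩) ≫ subι K = f := subLift_subι K f _
  have := mono_of_injective _ (subι_injective K)
  have : IsIso (subι K) := (Simple.mono_isIso_iff_nonzero (subι K)).2 fun h => hf <| by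
    rw [← hK, h, Limits.comp_zero]
  refine epi_of_surjective f fun s => ?_
  obtain ⟨x, rfl⟩ := surjective_of_epi (subι K) s
  exact subι_mem K x

theorem exists_ne_zero_of_simple [Simple S] : ∃ s : S.carrier, s ≠ 0 := by
  by_contra! h
  exact id_nonzero S (by ext s; exact h s)

theorem finite_of_simple [Simple S] : Module.Finite k S.carrier := by
  obtain ⟨s, hs⟩ := exists_ne_zero_of_simple (S := S)
  let K := Submodule.span (DualAlg k C) {s}
  have := mono_of_injective _ (subι_injective K)
  have : IsIso (subι K) := (Simple.mono_isIso_iff_nonzero (subι K)).2 fun h => hs <|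
    LinearMap.congr_fun (congrArg lin h) (subMk K ⟨s, Submodule.mem_span_singleton_self s⟩)
  have hfin : Module.Finite k (K.restrictScalars k) := finite_span_singleton s
  have htop : K.restrictScalars k = ⊤ :=
      (Submodule.eq_top_iff' (p := K.restrictScalars k)).2 fun x => by
        obtain ⟨y, rfl⟩ := surjective_of_epi (subι K) x
        exact subι_mem K y
  rw [htop] at hfin
  exact Module.Finite.equiv Submodule.topEquiv

theorem finite_ratComod {N : Type v} [AddCommGroup N] [Module k N] [Module (DualAlg k C) N]
    [IsScalarTower k (DualAlg k C) N] [Module.Finite k N] :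
    Module.Finite k (ratComod k C N).carrier :=
  Module.Finite.of_injective (ratPart k C N).subtype Subtype.val_injective

/-- The morphism `M ⟶ C`, `m ↦ ⟨l, m₀⟩ m₁`, given by a linear form `l` on `M`. -/
def toRegular (l : M.carrier →ₗ[k] k) : M ⟶ regularComod k C :=
  have key : ∀ (g : DualAlg k C) (m : M.carrier), g.ofConv (((TensorProduct.lid k C).toLinearMap ∘ₗ
      l.rTensor C ∘ₗ M.coact) m) = l (g • m) := fun g m => by
    change _ = l (tensorEval g (M.coact m))
    simp only [LinearMap.comp_apply]
    generalize M.coact m = t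
    induction t with
    | zero => simp
    | add x y hx hy => simp only [hx, hy, map_add]
    | tmul x y => simp [mul_comm]
  ofDualLin (N := regularComod k C)
    { toFun := (TensorProduct.lid k C).toLinearMap ∘ₗ l.rTensor C ∘ₗ M.coact
      map_add' := map_add _
      map_smul' := fun f m => eq_of_forall_dualAlg (k := k) (C := C) fun g => by
        refine (key g _).trans ?_
        rw [← mul_smul, ← key]
        exact convMul_apply_left g f _ }

theorem regularCounit_toRegular (l : M.carrier →ₗ[k] k) (m : M.carrier) :
    regularCounit k C (lin (toRegular l) m) = l m := by
  change Coalgebra.counit (TensorProduct.lid k C (l.rTensor C (M.coact m))) = _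
  have h := congrArg l (LinearMap.congr_fun M.counit_coact m)
  simp only [LinearMap.comp_apply, LinearMap.id_apply] at h
  rw [← h]
  generalize M.coact m = t
  induction t with
  | zero => simp
  | add x y hx hy => simp only [hx, hy, map_add]
  | tmul x y => simp [mul_comm]

theorem ofConv_toRegular (l : M.carrier →ₗ[k] k) (f : DualAlg k C) (m : M.carrier) :
    f.ofConv (lin (toRegular l) m) = l (f • m) := by
  rw [← regularCounit_toRegular, lin_smul, regularCounit_smul]

/-- Functionals extend, so `C` is injective among right comodules. -/
instance injective_regularComod : Injective (regularComod k C) where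
  factors {X Y} f g _ := by
    obtain ⟨r, hr⟩ := LinearMap.exists_leftInverse_of_injective (lin g)
      (LinearMap.ker_eq_bot.2 (injective_of_mono g))
    refine ⟨toRegular (regularCounit k C ∘ₗ lin f ∘ₗ r), ?_⟩
    ext1
    refine LinearMap.ext fun x => LinearMap.congr_fun (f := dualLin (g ≫ toRegular _))
      (g := dualLin f) (eq_of_counit_eq fun m => ?_) x
    refine (regularCounit_toRegular _ _).trans ?_
    exact congrArg (fun y => regularCounit k C (lin f y)) (LinearMap.congr_fun hr m)

end Comod

open Comod

variable {E : Submodule (DualAlg k C) (regularComod k C).carrier}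

/-- A direct summand of the comodule `C`, as a retract. -/
def retractOfProjection (r : (regularComod k C).carrier →ₗ[DualAlg k C] (regularComod k C).carrier)
    (hr : ∀ x, r x ∈ E) (hr' : ∀ x ∈ E, r x = x) : Retract (sub E) (regularComod k C) where
  i := subι E
  r := subLift E (ofDualLin r) hr
  retract := by
    ext x
    refine subι_injective E ?_
    exact hr' _ (subι_mem E x)

/-- A direct summand of `C` is injective, so it is an injective hull of any comodule embedded in it
as an essential submodule. -/
theorem isInjectiveHull_subLift (hE : IsRetractSubmodule E) {S : Comod k C}
    (i : S ⟶ regularComod k C) [Mono i]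
    (hess : IsEssentialIn (LinearMap.range (dualLin i)) E) :
    IsInjectiveHull (subLift E i fun s => hess.1 ⟨s, rfl⟩) := by
  obtain ⟨r, hr, hr'⟩ := hE
  refine ⟨(retractOfProjection r hr hr').injective, ?_, fun X g hg => ?_⟩
  · exact mono_of_injective _ fun x y hxy =>
      Comod.injective_of_mono i (congrArg (lin (subι E)) hxy)
  · have hK := hess.2 ((LinearMap.ker (dualLin g)).map (dualLin (subι E))) ?_ ?_
    · refine mono_of_injective g ((injective_iff_map_eq_zero (lin g)).2 fun x hx => ?_)
      refine subι_injective E (Eq.trans ?_ (map_zero (lin (subι E))).symm)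
      exact (Submodule.eq_bot_iff _).1 hK _ ⟨x, hx, rfl⟩
    · rintro _ ⟨x, -, rfl⟩
      exact subι_mem E x
    · refine Submodule.disjoint_def.2 ?_
      rintro _ ⟨s, rfl⟩ ⟨x, hx, hxs⟩
      have h1 : x = lin (subLift E i fun s => hess.1 ⟨s, rfl⟩) s := subι_injective E hxs
      have h2 : s = 0 := (injective_iff_map_eq_zero _).1
        (Comod.injective_of_mono (subLift E i (fun s => hess.1 ⟨s, rfl⟩) ≫ g)) s
        ((congrArg (lin g) h1.symm).trans hx)
      rw [h2, map_zero]

/-- By the dual basis property, a finite-dimensional direct summand of `C` is projective. -/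
theorem LeftTorsionless.projective_sub (h : LeftTorsionless k C) (hE : IsRetractSubmodule E)
    (hfin : Module.Finite k (E.restrictScalars k)) : Projective (sub E) where
  factors {Y X} f p _ := by
    obtain ⟨r, hr, hr'⟩ := hE
    have : Module.Finite k E := hfin
    obtain ⟨n, B, c, hB⟩ := h.exists_dual_basis E
    let ρ : Retract (sub E) (regularComod k C) := retractOfProjection r hr hr'
    choose x hx using fun j => surjective_of_epi p (lin f (lin ρ.r (c j)))
    refine ⟨ofDualLin (∑ j, (LinearMap.toSpanSingleton (DualAlg k C) _ (x j)) ∘ₗ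
      formToDual (B j).2 ∘ₗ dualLin (subι E)), ?_⟩
    ext d
    have h1 : lin ρ.r (lin (subι E) d) = d := LinearMap.congr_fun (congrArg lin ρ.retract) d
    have h2 := congrArg (lin f) (congrArg (lin ρ.r) (hB _ (subι_mem E d)))
    rw [h1, map_sum, map_sum] at h2
    rw [lin_comp, LinearMap.comp_apply, lin_ofDualLin, LinearMap.sum_apply, map_sum, h2]
    refine Finset.sum_congr rfl fun j _ => ?_
    rw [lin_smul, lin_smul, ← hx j]
    exact lin_smul p _ _

/-- A finite-dimensional projective comodule with simple essential socle covers all of its nonzero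
quotients: of two endomorphisms `h` and `1 - h`, one is injective, hence bijective. -/
theorem isProjectiveCover_of_isInjectiveHull {S P Q : Comod k C} [Simple S] [Projective P]
    [Module.Finite k P.carrier] {i : S ⟶ P} (hi : IsInjectiveHull i) (q : P ⟶ Q) [Epi q]
    (hq : q ≠ 0) : IsProjectiveCover q where
  projective := inferInstance
  epi := inferInstance
  superfluous X g _ := by
    have isIso_of_mono : ∀ h : P ⟶ P, Mono h → IsIso h := fun h _ => isIso_of_bijective h
      ⟨injective_of_mono h, LinearMap.injective_iff_surjective.1 (injective_of_mono h)⟩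
    let l : P ⟶ X := Projective.factorThru q (g ≫ q)
    have hl : (l ≫ g) ≫ q = q := by
      rw [Category.assoc]; exact Projective.factorThru_comp q (g ≫ q)
    by_cases h0 : i ≫ l ≫ g = 0
    · exfalso
      have h1 : i ≫ (𝟙 P - l ≫ g) = i := by
        rw [Preadditive.comp_sub, h0, sub_zero, Category.comp_id]
      have := isIso_of_mono _ (hi.essential (𝟙 P - l ≫ g) (h1.symm ▸ hi.mono))
      refine hq ((cancel_epi (𝟙 P - l ≫ g)).1 ?_)
      rw [Preadditive.sub_comp, hl, Category.id_comp, sub_self, Limits.comp_zero]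
    · have := isIso_of_mono _ (hi.essential (l ≫ g) (mono_of_ne_zero h0))
      exact epi_of_epi l g

/-- The injective hull of a simple comodule `S` is a projective cover of `C ⊗_{C^*} S`: it is a
direct summand `E` of `C`, and `x ↦ x ⊗ s` is a nonzero map from `E` to a simple comodule. -/
theorem exists_isInjectiveHull_isProjectiveCover (h : IsQcF k C) (S : Comod k C) [Simple S] :
    ∃ (E : Comod k C) (i : S ⟶ E) (q : E ⟶ (nakR k C).obj S),
      IsInjectiveHull i ∧ IsProjectiveCover q := by
  obtain ⟨hl, hr⟩ := (isQcF_iff_torsionless k C).1 h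
  have := nakR_isEquivalence hl hr
  have := simple_obj (nakR k C) S
  obtain ⟨s, hs⟩ := exists_ne_zero_of_simple (S := S)
  obtain ⟨l, hls⟩ : ∃ l : Module.Dual k S.carrier, l s ≠ 0 := by
    by_contra! H
    exact hs ((Module.forall_dual_apply_eq_zero_iff k s).1 H)
  have : Mono (toRegular l) := mono_of_ne_zero fun h0 => hls <| by
    rw [← regularCounit_toRegular, h0]; exact map_zero _
  have := finite_of_simple (S := S)
  have hN : Module.Finite k ((LinearMap.range (dualLin (toRegular l))).restrictScalars k) :=
    Module.Finite.range (lin (toRegular l))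
  obtain ⟨E, hfin, hret, hess⟩ := (separatesDisjoint_left k C).exists_essential_retract
    hl.hasFiniteRankUnits _ hN
  have hi := isInjectiveHull_subLift hret (toRegular l) hess
  have := hl.projective_sub hret hfin
  have : Module.Finite k E := hfin
  have := finite_ratComod (k := k) (C := C) (N := E)
  let q : sub E ⟶ (nakR k C).obj S := subι E ≫ tmulHom S s
  have hq : q ≠ 0 := by
    intro hq
    obtain ⟨r, hr, hr'⟩ := hret
    -- a functional `e` with `c ↼ e = r c`; it does not kill `s` because `r` fixes its image
    let e := endFunctional r
    have hre : ∀ c : C, coalgActR k e c = r c := fun c =>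
      (LinearMap.congr_fun (eq_coalgActREnd r) c).symm
    have hes : e • s ≠ 0 := fun h0 => hls <| by
      have h1 := congrArg (regularCounit k C) (hr' _ (hess.1 ⟨s, rfl⟩))
      refine (regularCounit_toRegular l s).symm.trans (h1.symm.trans ?_)
      refine (ofConv_toRegular l e s).trans ?_
      rw [h0, map_zero]
    refine hes (hl.eq_zero_of_balancedTmul_eq_zero (LinearMap.ext fun c => ?_))
    refine (LinearMap.congr_fun (balancedTmul_act S e s) c).trans ?_
    rw [LinearMap.comp_apply, hre]
    exact LinearMap.congr_fun (congrArg lin hq) (subMk E ⟨_, hr c⟩)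
  have := epi_of_ne_zero hq
  exact ⟨_, _, q, hi, isProjectiveCover_of_isInjectiveHull hi q hq⟩

end HullsAndCovers

end

theorem mainTheorem1 (k : Type u) (C : Type v) [Field k] [AddCommGroup C] [Module k C]
    [Coalgebra k C] :
    [IsQcF k C,
      (nakL k C).IsEquivalence,
      (nakR k C).IsEquivalence,
      Limits.PreservesFiniteLimits (nakR k C) ∧ Limits.PreservesFiniteColimits (nakR k C) ∧
        (nakR k C).Faithful].TFAE ∧
    (IsQcF k C → ∀ S : Comod k C, Simple S →
      ((∃ (P : Comod k C) (p : P ⟶ S), IsProjectiveCover p) ∧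
        (∃ (E : Comod k C) (i : (nakL k C).obj S ⟶ E), IsInjectiveHull i) ∧
        ∀ (P : Comod k C) (p : P ⟶ S) (E : Comod k C) (i : (nakL k C).obj S ⟶ E),
          IsProjectiveCover p → IsInjectiveHull i → Nonempty (P ≅ E)) ∧
      ((∃ (E : Comod k C) (i : S ⟶ E), IsInjectiveHull i) ∧
        (∃ (P : Comod k C) (p : P ⟶ (nakR k C).obj S), IsProjectiveCover p) ∧
        ∀ (E : Comod k C) (i : S ⟶ E) (P : Comod k C) (p : P ⟶ (nakR k C).obj S),
          IsInjectiveHull i → IsProjectiveCover p → Nonempty (E ≅ P))) := by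
  refine ⟨isQcF_tfae k C, fun h S _ => ?_⟩
  have hR : (nakR k C).IsEquivalence := ((isQcF_tfae k C).out 0 2).1 h
  have hL : (nakL k C).IsEquivalence := ((isQcF_tfae k C).out 0 1).1 h
  obtain ⟨E, i, q, hi, hq⟩ := exists_isInjectiveHull_isProjectiveCover h S
  -- the functor `Hom^C(C, -)^rat` carries the cover of `C ⊗_{C^*} S` to one of `S`
  have hiL := hi.map (nakL k C)
  have hqL := (hq.map (nakL k C)).comp_iso (asIso ((nakAdjunction k C).unit.app S)).symm
  refine ⟨⟨⟨_, _, hqL⟩, ⟨_, _, hiL⟩, fun P p F j hp hj => ?_⟩,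
    ⟨_, _, hi⟩, ⟨_, _, hq⟩, fun F j P p hj hp => ?_⟩
  · exact ⟨(hp.nonempty_iso hqL).some ≪≫ (hiL.nonempty_iso hj).some⟩
  · exact ⟨(hj.nonempty_iso hi).some ≪≫ (hq.nonempty_iso hp).some⟩
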